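/- \textbf{Theorem (Hyers--Ulam stability).} Let $\mathbb{T}\subseteq\mathbb{R}$ be a time scale (a nonempty closed set) with forward jump operator $\sigma$ ($\sigma(t)=\inf\{s\in\mathbb{T}: s>t\}$, and $\sigma(t)=t$ if $t=\max\mathbb{T}$) and graininess $\mu(t)=\sigma(t)-t$; write $[a,b]_{\mathbb{T}}=[a,b]\cap\mathbb{T}$. Let $n\ge 1$ and let $a\le b$ and $d\ge\sigma^n(b)$ be points of $\mathbb{T}$. All functions are real-valued functions on $E=[a,d]_{\mathbb{T}}$ (for instance with $d=\sigma^n(b)$), and $y^\Delta(t)$ is the delta derivative on $E$: the number $D$ such that for every $\eta>0$ one has $|y(\sigma(t))-y(s)-D(\sigma(t)-s)|\le\eta|\sigma(t)-s|$ for all $s\in E$ near $t$. Assume that $\sigma^{n-1}(b)<d$ or that $\sigma^{n-1}(b)=d$ is a limit of points of $E$ from the left, so that the delta derivatives below are unique. A function on an interval of $\mathbb{T}$ is rd-continuous ($C_{rd}$) if it is continuous at the points with $\sigma(t)=t$ and has finite left-sided limits at left-dense points; it is $C^1_{rd}$ on an interval if it is delta differentiable at each point of it with a derivative that is rd-continuous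 on it. Let $\varphi,f\in C_{rd}(E)$, let $\alpha_0,\dots,\alpha_n\in\mathbb{R}$ with $\alpha_n=1$, and consider the equation $$\sum_{k=0}^n\alpha_kM_ky(t)=f(t),\quad t\in[a,b]_{\mathbb{T}},\qquad M_0y=y,\quad M_{k+1}y=\varphi\,(M_ky)^\Delta. \tag{1}$$ Let $\lambda_1,\dots,\lambda_n\in\mathbb{C}$ be the characteristic values: $\alpha_k=s_{n-k}(-\lambda_1,\dots,-\lambda_n)$ for $0\le k\le n$, where $s_j$ is the $j$-th elementary symmetric polynomial. Assume that there is a constant $A>0$ such that, for all $t\in[a,\sigma^{n-1}(b)]_{\mathbb{T}}$, $$|\varphi(t)|\ge A\qquad\text{and}\qquad \varphi(t)+\lambda_k\mu(t)\ne 0,\quad k=1,\dots,n.$$ Then (1) has Hyers--Ulam stability on $[a,b]_{\mathbb{T}}$: there is a constant $K>0$ such that for every $\varepsilon>0$ and every $x$ with $M_kx\in C^1_{rd}$ on $[a,b]_{\mathbb{T}}$ for $0\le k\le n-1$ and $$\Big|\sum_{k=0}^n\alpha_kM_kx(t)-f(t)\Big|\le\varepsilon,\qquad t\in[a,b]_{\mathbb{T}},$$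 there is a solution $u$ of (1), with $M_ku\in C^1_{rd}$ on $[a,\sigma^{n-1-k}(b)]_{\mathbb{T}}\supseteq[a,b]_{\mathbb{T}}$ for $0\le k\le n-1$, such that $|x(t)-u(t)|\le K\varepsilon$ for all $t\in[a,\sigma^n(b)]_{\mathbb{T}}$. -/

import Mathlib

open Set Filter Topology

noncomputable section

namespace TimeScale

/-- The closed interval `[a, b]_T` of the time scale `T`. -/
def interval (T : Set ℝ) (a b : ℝ) : Set ℝ := T ∩ Icc a b

/-- The forward jump operator `σ` of the time scale `T`; it fixes the maximum of `T`, if any. -/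
def sigma (T : Set ℝ) (t : ℝ) : ℝ :=
  open Classical in if (T ∩ Ioi t).Nonempty then sInf (T ∩ Ioi t) else t

/-- The graininess `μ(t) = σ(t) - t`. -/
def mu (T : Set ℝ) (t : ℝ) : ℝ := sigma T t - t

/-- `E^κ`: the points of `E` at which a delta derivative of a function on `E` is unique, that is,
all points of `E` but a maximum of `E` that is not a limit from the left of points of `E`. -/
def kappa (E : Set ℝ) : Set ℝ :=
  {t ∈ E | (∃ s ∈ E, t < s) ∨ t ∈ closure (E ∩ Iio t)}

/-- The function `y`, considered on the subset `E` of the time scale `T`, has the delta derivative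
`D` at `t`: for every `ε > 0` one has `|y(σ(t)) - y(s) - D (σ(t) - s)| ≤ ε |σ(t) - s|` for all
`s ∈ E` near `t`. -/
def HasDeltaDeriv (T E : Set ℝ) (y : ℝ → ℝ) (D t : ℝ) : Prop :=
  ∀ ε > 0, ∀ᶠ s in 𝓝[E] t,
    |y (sigma T t) - y s - D * (sigma T t - s)| ≤ ε * |sigma T t - s|

/-- The delta derivative `y^Δ` (with the default value `0` where it does not exist). -/
def deltaDeriv (T E : Set ℝ) (y : ℝ → ℝ) (t : ℝ) : ℝ :=
  open Classical in if h : ∃ D, HasDeltaDeriv T E y D t then h.choose else 0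

/-- `g` is rd-continuous on the subset `S` of `T`: continuous at the points with `σ(t) = t`, with
finite left-sided limits at the left-dense points. -/
def RdContinuousOn (T S : Set ℝ) (g : ℝ → ℝ) : Prop :=
  (∀ t ∈ S, sigma T t = t → ContinuousWithinAt g S t) ∧
  (∀ t ∈ S, t ∈ closure (S ∩ Iio t) → ∃ l : ℝ, Tendsto g (𝓝[S ∩ Iio t] t) (𝓝 l))

/-- The class `C¹_rd` on `S`, for functions on `E ⊇ S`: delta differentiable at every point of `S`,
with a derivative that is rd-continuous on `S`. -/
def CrdOne (T E S : Set ℝ) (y : ℝ → ℝ) : Prop :=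
  (∀ t ∈ S, ∃ D, HasDeltaDeriv T E y D t) ∧ RdContinuousOn T S (deltaDeriv T E y)

/-- `M_0 y = y`, `M_{k+1} y = φ (M_k y)^Δ`. -/
def M (T E : Set ℝ) (φ : ℝ → ℝ) : ℕ → (ℝ → ℝ) → ℝ → ℝ
  | 0, y => y
  | k + 1, y => fun t => φ t * deltaDeriv T E (M T E φ k y) t

/-- The left-hand side `∑_{k=0}^n α_k M_k y` of the Cauchy-Euler equation. -/
def cauchyEuler (T E : Set ℝ) (n : ℕ) (α : ℕ → ℝ) (φ y : ℝ → ℝ) (t : ℝ) : ℝ :=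
  ∑ k ∈ Finset.range (n + 1), α k * M T E φ k y t

/-- The elementary symmetric polynomial `s_j(ρ_1, …, ρ_n)`. -/
def elemSymm {n : ℕ} (j : ℕ) (ρ : Fin n → ℂ) : ℂ :=
  ∑ S ∈ Finset.powersetCard j Finset.univ, ∏ i ∈ S, ρ i

/-- Hyers-Ulam stability on `[a, b]_T` of the equation `∑_{k=0}^n α_k M_k y = f`, for functions
given on `E ⊇ [a, σⁿ(b)]_T`. The constant `K` depends neither on `ε` nor on `x`. -/
def HyersUlamStable (T E : Set ℝ) (a b : ℝ) (n : ℕ) (α : ℕ → ℝ) (φ f : ℝ → ℝ) : Prop :=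
  ∃ K > 0, ∀ ε > 0, ∀ x : ℝ → ℝ,
    (∀ k < n, CrdOne T E (interval T a b) (M T E φ k x)) →
    (∀ t ∈ interval T a b, |cauchyEuler T E n α φ x t - f t| ≤ ε) →
    ∃ u : ℝ → ℝ,
      (∀ k < n, CrdOne T E (interval T a ((sigma T)^[n - 1 - k] b)) (M T E φ k u)) ∧
      (∀ t ∈ interval T a b, cauchyEuler T E n α φ u t = f t) ∧
      ∀ t ∈ interval T a ((sigma T)^[n] b), |x t - u t| ≤ K * ε

end TimeScale

end

/-!
Put `w = 1 / φ`, suitably continued to the part of `[a, d]_T` where `φ` may vanish. The equation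
is the first-order system `(M_k u)^Δ = w M_{k+1} u`, `k < n`, in which `M_n u` is eliminated by
means of `∑ α_k M_k u = f`. Extending the right-hand side of this system as a step function to the
gaps of `T` turns delta integrals into Lebesgue integrals, so Picard iteration solves it from `a`
to `d` with the initial values of `x`.

On `[a, b]_T` the differences `M_k x - M_k u` satisfy the same system with zero initial values and
with a function bounded by `ε` in place of `f`, so Grönwall's inequality bounds all of them,
including the one with `k = n`, by a multiple of `ε`. What remains of `[a, σⁿ(b)]_T` are the
points `σʲ(b)`, `j ≤ n`, and `M_k x (σ(t)) = M_k x(t) + μ(t) w(t) M_{k+1} x(t)` lets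
`M_k x - M_k u` be bounded at `σʲ(b)` for `k + j ≤ n`, by induction on `j`.
-/

noncomputable section

namespace TimeScale

open MeasureTheory
open scoped NNReal

section Jump

variable {T : Set ℝ} {s t r : ℝ}

theorem le_sigma (T : Set ℝ) (t : ℝ) : t ≤ sigma T t := by
  unfold sigma
  split_ifs with h
  · exact le_csInf h fun s hs => hs.2.le
  · exact le_rfl

theorem sigma_le_of_lt (hs : s ∈ T) (hts : t < s) : sigma T t ≤ s := by
  rw [sigma, if_pos ⟨s, hs, hts⟩]
  exact csInf_le ⟨t, fun r hr => hr.2.le⟩ ⟨hs, hts⟩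

theorem le_of_lt_sigma (hs : s ∈ T) (hst : s < sigma T t) : s ≤ t :=
  not_lt.1 fun hts => hst.not_ge (sigma_le_of_lt hs hts)

theorem sigma_le_sigma (ht : t ∈ T) (hst : s ≤ t) : sigma T s ≤ sigma T t := by
  rcases hst.eq_or_lt with rfl | hst
  · exact le_rfl
  · exact (sigma_le_of_lt ht hst).trans (le_sigma T t)

theorem sigma_mem (hT : IsClosed T) (ht : t ∈ T) : sigma T t ∈ T := by
  unfold sigma
  split_ifs with h
  · exact hT.closure_subset_iff.2 inter_subset_left
      (csInf_mem_closure h ⟨t, fun r hr => hr.2.le⟩)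
  · exact ht

theorem exists_mem_Ioo_of_sigma_eq (hs : s ∈ T) (hts : t < s) (h : sigma T t = t) (hr : t < r) :
    ∃ p ∈ T, p ∈ Ioo t r := by
  have hne : (T ∩ Ioi t).Nonempty := ⟨s, hs, hts⟩
  rw [sigma, if_pos hne] at h
  obtain ⟨p, hp, hpr⟩ := exists_lt_of_csInf_lt hne (h.trans_lt hr)
  exact ⟨p, hp.1, hp.2, hpr⟩

theorem iterate_sigma_mem (hT : IsClosed T) (ht : t ∈ T) (j : ℕ) : (sigma T)^[j] t ∈ T := by
  induction j with
  | zero => exact ht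
  | succ j ih => rw [Function.iterate_succ_apply']; exact sigma_mem hT ih

theorem monotone_iterate_sigma (T : Set ℝ) (t : ℝ) : Monotone fun j => (sigma T)^[j] t :=
  monotone_nat_of_le_succ fun j => by
    rw [Function.iterate_succ_apply']; exact le_sigma _ _

theorem le_iterate_sigma (T : Set ℝ) (t : ℝ) (j : ℕ) : t ≤ (sigma T)^[j] t :=
  monotone_iterate_sigma T t (Nat.zero_le j)

theorem exists_iterate_sigma_eq (hs : s ∈ T) (hts : t < s) {n : ℕ}
    (hsn : s ≤ (sigma T)^[n] t) : ∃ j ≤ n, s = (sigma T)^[j] t := by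
  induction n with
  | zero => exact absurd hsn (not_le.2 hts)
  | succ n ih =>
    rcases le_or_gt s ((sigma T)^[n] t) with h | h
    · obtain ⟨j, hj, rfl⟩ := ih h
      exact ⟨j, hj.trans n.le_succ, rfl⟩
    · refine ⟨n + 1, le_rfl, hsn.antisymm ?_⟩
      rw [Function.iterate_succ_apply']
      exact sigma_le_of_lt hs h

theorem interval_subset_interval {a b c : ℝ} (h : b ≤ c) : interval T a b ⊆ interval T a c :=
  inter_subset_inter_right _ (Icc_subset_Icc_right h)

theorem isCompact_interval (hT : IsClosed T) (a b : ℝ) : IsCompact (interval T a b) :=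
  isCompact_Icc.inter_left hT

variable {E : Set ℝ}

theorem eventually_le_of_lt_sigma (hE : E ⊆ T) (hσ : t < sigma T t) : ∀ᶠ s in 𝓝[E] t, s ≤ t := by
  filter_upwards [self_mem_nhdsWithin, nhdsWithin_le_nhds (Iio_mem_nhds hσ)] with s hs hst
  exact le_of_lt_sigma (hE hs) hst

theorem eventually_comp_sigma (hE : E ⊆ T) (ht : t ∈ T) {p : ℝ → Prop}
    (hσ : ∀ᶠ s in 𝓝[E] t, sigma T s ∈ E) (hp : ∀ᶠ s in 𝓝[E] t, p s) (hpσ : p (sigma T t)) :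
    ∀ᶠ s in 𝓝[E] t, p (sigma T s) := by
  obtain ⟨l, r, ⟨hl, hr⟩, hlr⟩ :=
    mem_nhds_iff_exists_Ioo_subset.1 (mem_nhdsWithin_iff_eventually.1 hp)
  by_cases! hq : ∃ q ∈ E, q ∈ Ioo t r
  · obtain ⟨q, hqE, htq, hqr⟩ := hq
    filter_upwards [hσ, nhdsWithin_le_nhds (Ioo_mem_nhds hl htq)] with s hs hsq
    exact hlr ⟨hsq.1.trans_le (le_sigma T s),
      (sigma_le_of_lt (hE hqE) hsq.2).trans_lt hqr⟩ hs
  · filter_upwards [hσ, self_mem_nhdsWithin, nhdsWithin_le_nhds (Ioo_mem_nhds hl hr)]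
      with s hs hsE hslr
    rcases lt_trichotomy s t with hst | rfl | hst
    · exact hlr ⟨hslr.1.trans_le (le_sigma T s), (sigma_le_of_lt ht hst).trans_lt hr⟩ hs
    · exact hpσ
    · exact absurd ⟨hst, hslr.2⟩ (hq s hsE)

theorem mem_kappa_of_lt (ht : t ∈ E) (hs : s ∈ E) (hts : t < s) : t ∈ kappa E :=
  ⟨ht, Or.inl ⟨s, hs, hts⟩⟩

theorem eventually_mem_kappa (ht : t ∈ kappa E) : ∀ᶠ s in 𝓝[E] t, s ∈ kappa E := by
  by_cases! h : ∃ s ∈ E, t < s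
  · obtain ⟨r, hr, htr⟩ := h
    filter_upwards [self_mem_nhdsWithin, nhdsWithin_le_nhds (Iio_mem_nhds htr)] with s hs hsr
    exact mem_kappa_of_lt hs hr hsr
  · filter_upwards [self_mem_nhdsWithin] with s hs
    rcases (h s hs).eq_or_lt with rfl | hst
    exacts [ht, mem_kappa_of_lt hs ht.1 hst]

theorem eventually_sigma_le {d : ℝ} (hd : d ∈ T) (hE : E ⊆ Iic d) (ht : sigma T t ≤ d) :
    ∀ᶠ s in 𝓝[E] t, sigma T s ≤ d := by
  rcases ((le_sigma T t).trans ht).eq_or_lt with rfl | htd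
  · filter_upwards [self_mem_nhdsWithin] with s hs
    exact (sigma_le_sigma hd (hE hs)).trans ht
  · filter_upwards [nhdsWithin_le_nhds (Iio_mem_nhds htd)] with s hs
    exact sigma_le_of_lt hd hs

end Jump

section DeltaDeriv

variable {T E : Set ℝ} {y z : ℝ → ℝ} {D D' t : ℝ}

theorem HasDeltaDeriv.sub (hy : HasDeltaDeriv T E y D t) (hz : HasDeltaDeriv T E z D' t) :
    HasDeltaDeriv T E (fun s => y s - z s) (D - D') t := by
  intro ε hε
  filter_upwards [hy (ε / 2) (by positivity), hz (ε / 2) (by positivity)] with s h1 h2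
  calc |y (sigma T t) - z (sigma T t) - (y s - z s) - (D - D') * (sigma T t - s)|
      = |(y (sigma T t) - y s - D * (sigma T t - s))
          - (z (sigma T t) - z s - D' * (sigma T t - s))| := by ring_nf
    _ ≤ ε / 2 * |sigma T t - s| + ε / 2 * |sigma T t - s| :=
        (abs_sub _ _).trans (add_le_add h1 h2)
    _ = ε * |sigma T t - s| := by ring

theorem HasDeltaDeriv.const_add (hy : HasDeltaDeriv T E y D t) (c : ℝ) :
    HasDeltaDeriv T E (fun s => c + y s) D t := by
  simpa only [HasDeltaDeriv, add_sub_add_left_eq_sub] using hy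

theorem HasDeltaDeriv.congr (hy : HasDeltaDeriv T E y D t) (h : ∀ᶠ s in 𝓝[E] t, z s = y s)
    (hσ : z (sigma T t) = y (sigma T t)) : HasDeltaDeriv T E z D t := by
  intro ε hε
  filter_upwards [hy ε hε, h] with s h1 h2
  rwa [hσ, h2]

theorem HasDeltaDeriv.apply_sigma (hy : HasDeltaDeriv T E y D t) (ht : t ∈ E) :
    y (sigma T t) = y t + D * mu T t := by
  have hle (ε : ℝ) (hε : 0 < ε) :
      |y (sigma T t) - y t - D * mu T t| ≤ ε * |mu T t| :=
    (hy ε hε).self_of_nhdsWithin ht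
  have hlim : Tendsto (fun ε : ℝ => ε * |mu T t|) (𝓝[>] 0) (𝓝 (0 * |mu T t|)) :=
    (tendsto_id.mul_const _).mono_left nhdsWithin_le_nhds
  have h0 := ge_of_tendsto hlim (eventually_mem_nhdsWithin.mono hle)
  rw [zero_mul, abs_nonpos_iff] at h0
  linarith

theorem HasDeltaDeriv.eventually_abs_sub_le (hy : HasDeltaDeriv T E y D t) (ht : t ∈ E) {ε : ℝ}
    (hε : 0 < ε) : ∀ᶠ s in 𝓝[E] t, |y s - y t| ≤ |D| * |s - t| + ε * |sigma T t - s| := by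
  filter_upwards [hy ε hε] with s hs
  have hσ : y (sigma T t) = y t + D * (sigma T t - t) := hy.apply_sigma ht
  calc |y s - y t| = |D * (s - t) - (y (sigma T t) - y s - D * (sigma T t - s))| := by
        rw [hσ]; ring_nf
    _ ≤ |D| * |s - t| + ε * |sigma T t - s| := by
        rw [← abs_mul]; exact (abs_sub _ _).trans (add_le_add_right hs _)

theorem HasDeltaDeriv.continuousWithinAt (hy : HasDeltaDeriv T E y D t) (ht : t ∈ E) :
    ContinuousWithinAt y E t := by
  rw [Metric.continuousWithinAt_iff']
  intro η hη
  obtain ⟨ε, hε, hεη⟩ : ∃ ε > 0, ε * |sigma T t - t| < η := by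
    obtain ⟨ε, hε, h⟩ := exists_pos_mul_lt hη |sigma T t - t|
    exact ⟨ε, hε, by rwa [mul_comm]⟩
  have hlim : ContinuousAt (fun s => |D| * |s - t| + ε * |sigma T t - s|) t := by fun_prop
  have hlt : ∀ᶠ s in 𝓝[E] t, |D| * |s - t| + ε * |sigma T t - s| < η :=
    nhdsWithin_le_nhds (hlim.eventually_lt_const (by simpa using hεη))
  filter_upwards [hy.eventually_abs_sub_le ht hε, hlt] with s h1 h2
  exact h1.trans_lt h2

theorem deltaDeriv_spec (h : ∃ D, HasDeltaDeriv T E y D t) :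
    HasDeltaDeriv T E y (deltaDeriv T E y t) t := by
  rw [deltaDeriv, dif_pos h]
  exact h.choose_spec

theorem HasDeltaDeriv.unique_of_frequently (hy : HasDeltaDeriv T E y D t)
    (hy' : HasDeltaDeriv T E y D' t) (h : ∃ᶠ s in 𝓝[E] t, s ≠ sigma T t) : D = D' := by
  refine eq_of_abs_sub_le_all fun ε hε => ?_
  obtain ⟨s, hs, h1, h2⟩ := (h.and_eventually
    ((hy (ε / 2) (by positivity)).and (hy' (ε / 2) (by positivity)))).exists
  refine le_of_mul_le_mul_right ?_ (abs_pos.2 (sub_ne_zero.2 hs.symm))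
  calc |D - D'| * |sigma T t - s|
      = |(y (sigma T t) - y s - D' * (sigma T t - s))
          - (y (sigma T t) - y s - D * (sigma T t - s))| := by rw [← abs_mul]; ring_nf
    _ ≤ ε / 2 * |sigma T t - s| + ε / 2 * |sigma T t - s| :=
        (abs_sub _ _).trans (add_le_add h2 h1)
    _ = ε * |sigma T t - s| := by ring

theorem frequently_ne_sigma {a d : ℝ} (ht : t ∈ kappa (interval T a d)) :
    ∃ᶠ s in 𝓝[interval T a d] t, s ≠ sigma T t := by
  obtain ⟨htE, h⟩ := ht
  by_cases hσ : sigma T t = t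
  · rw [hσ]
    rcases h with ⟨q, hq, htq⟩ | h
    · rw [frequently_nhdsWithin_iff, frequently_iff]
      intro U hU
      obtain ⟨r, htr, hrU⟩ := exists_Ico_subset_of_mem_nhds hU ⟨q, htq⟩
      obtain ⟨p, hp, htp, hpr⟩ := exists_mem_Ioo_of_sigma_eq hq.1 htq hσ (lt_min htr htq)
      exact ⟨p, hrU ⟨htp.le, hpr.trans_le (min_le_left r q)⟩, htp.ne', hp,
        htE.2.1.trans htp.le, (hpr.trans_le (min_le_right r q)).le.trans hq.2.2⟩
    · have := mem_closure_iff_nhdsWithin_neBot.1 h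
      have hne : ∃ᶠ s in 𝓝[interval T a d ∩ Iio t] t, s ≠ t :=
        (eventually_mem_nhdsWithin.mono fun s hs => (hs.2 : s < t).ne).frequently
      exact hne.filter_mono (nhdsWithin_mono _ inter_subset_left)
  · exact frequently_iff.2 fun hU => ⟨t, mem_of_mem_nhdsWithin htE hU, Ne.symm hσ⟩

theorem HasDeltaDeriv.deltaDeriv_eq {a d : ℝ} (hy : HasDeltaDeriv T (interval T a d) y D t)
    (ht : t ∈ kappa (interval T a d)) : deltaDeriv T (interval T a d) y t = D :=
  (deltaDeriv_spec ⟨D, hy⟩).unique_of_frequently hy (frequently_ne_sigma ht)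

theorem exists_hasDeltaDeriv_of_isolated (hσ : t < sigma T t) (h : ∀ᶠ s in 𝓝[E] t, s = t)
    (y : ℝ → ℝ) : ∃ D, HasDeltaDeriv T E y D t := by
  refine ⟨(y (sigma T t) - y t) / (sigma T t - t), fun ε hε => ?_⟩
  filter_upwards [h] with s hs
  rw [hs, div_mul_cancel₀ _ (sub_pos.2 hσ).ne', sub_self, abs_zero]
  positivity

theorem eventually_eq_sigma (hE : E ⊆ T) (ht : t < sigma T t)
    (hσ : sigma T t < sigma T (sigma T t)) : ∀ᶠ s in 𝓝[E] (sigma T t), s = sigma T t := by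
  filter_upwards [self_mem_nhdsWithin, eventually_le_of_lt_sigma hE hσ,
    nhdsWithin_le_nhds (Ioi_mem_nhds ht)] with s hs hsσ hts
  exact hsσ.antisymm (sigma_le_of_lt (hE hs) hts)

end DeltaDeriv

section Induction

variable {T : Set ℝ} {a b t : ℝ}

theorem exists_sigma_eq_of_notMem_closure (hT : IsClosed T) (ha : a ∈ T)
    (ht : t ∈ interval T a b) (hat : a < t) (hl : t ∉ closure (interval T a b ∩ Iio t)) :
    ∃ p ∈ interval T a b, p < t ∧ sigma T p = t := by
  set L := interval T a b ∩ Iio t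
  have hLt : ∀ s ∈ L, s < t := fun s hs => hs.2
  have hbdd : BddAbove L := ⟨t, fun s hs => (hLt s hs).le⟩
  have hne : L.Nonempty := ⟨a, ⟨ha, le_rfl, hat.le.trans ht.2.2⟩, hat⟩
  have hpL : sSup L ∈ closure L := csSup_mem_closure hne hbdd
  have hp : sSup L ∈ interval T a b :=
    (isCompact_interval hT a b).isClosed.closure_subset_iff.2 inter_subset_left hpL
  have hpt : sSup L < t :=
    (csSup_le hne fun s hs => (hLt s hs).le).lt_of_ne fun h => hl (h ▸ hpL)
  have hmem : ∀ q ∈ T, sSup L ≤ q → q < t → q ∈ L := fun q hq hpq hqt =>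
    ⟨⟨hq, hp.2.1.trans hpq, hqt.le.trans ht.2.2⟩, hqt⟩
  refine ⟨sSup L, hp, hpt, (sigma_le_of_lt ht.1 hpt).antisymm ?_⟩
  by_contra! hlt
  have hσ : sigma T (sSup L) = sSup L :=
    (le_csSup hbdd (hmem _ (sigma_mem hT hp.1) (le_sigma T _) hlt)).antisymm (le_sigma T _)
  obtain ⟨q, hq, hpq, hqt⟩ := exists_mem_Ioo_of_sigma_eq ht.1 hpt hσ hpt
  exact hpq.not_ge (le_csSup hbdd (hmem q hq hpq.le hqt))

theorem interval_induction (hT : IsClosed T) (ha : a ∈ T) {P : ℝ → Prop} (h0 : P a)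
    (hscat : ∀ t ∈ interval T a b, t < sigma T t → P t → P (sigma T t))
    (hright : ∀ t ∈ interval T a b, sigma T t = t → P t →
      ∀ᶠ s in 𝓝[interval T a b ∩ Ioi t] t, P s)
    (hleft : ∀ t ∈ interval T a b, t ∈ closure (interval T a b ∩ Iio t) →
      (∀ s ∈ interval T a b ∩ Iio t, P s) → P t) :
    ∀ t ∈ interval T a b, P t := by
  by_contra! hne
  set S := {t | t ∈ interval T a b ∧ ¬ P t}
  have hbdd : BddBelow S := ⟨a, fun s hs => hs.1.2.1⟩
  set m := sInf S
  have hm : m ∈ interval T a b :=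
    (isCompact_interval hT a b).isClosed.closure_subset_iff.2 (fun s hs => hs.1)
      (csInf_mem_closure hne hbdd)
  have hlt : ∀ s ∈ interval T a b ∩ Iio m, P s := fun s hs => by
    by_contra hP
    exact (csInf_le hbdd ⟨hs.1, hP⟩).not_gt hs.2
  have hPm : P m := by
    by_cases hl : m ∈ closure (interval T a b ∩ Iio m)
    · exact hleft m hm hl hlt
    rcases hm.2.1.eq_or_lt with ham | ham
    · rwa [← ham]
    · obtain ⟨p, hp, hpm, hσ⟩ := exists_sigma_eq_of_notMem_closure hT ha hm ham hl
      exact hσ ▸ hscat p hp (hσ ▸ hpm) (hlt p ⟨hp, hpm⟩)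
  have hgt : ∀ s ∈ S, m < s := fun s hs =>
    (csInf_le hbdd hs).lt_of_ne fun h => hs.2 (h ▸ hPm)
  obtain ⟨r, hmr, hr⟩ : ∃ r > m, ∀ s ∈ interval T a b, m < s → s < r → P s := by
    rcases (le_sigma T m).eq_or_lt with hσ | hσ
    · obtain ⟨s, hs⟩ := hne
      obtain ⟨r, hmr, hr⟩ := exists_Ico_subset_of_mem_nhds
        (mem_nhdsWithin_iff_eventually.1 (hright m hm hσ.symm hPm)) ⟨s, hgt s hs⟩
      exact ⟨r, hmr, fun q hq hmq hqr => hr ⟨hmq.le, hqr⟩ ⟨hq, hmq⟩⟩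
    · exact ⟨sigma T m, hσ, fun s hs hms hsσ => absurd (le_of_lt_sigma hs.1 hsσ) hms.not_ge⟩
  obtain ⟨s, hs, hsr⟩ := exists_lt_of_csInf_lt hne hmr
  exact hs.2 (hr s hs.1 (hgt s hs) hsr)

end Induction

section Gronwall

variable {T E : Set ℝ} {a b t : ℝ} {ι : Type*} [Fintype ι] {W : ℝ → ι → ℝ}

theorem gronwallBound_add_le {δ K ε x : ℝ} (hδ : 0 ≤ δ) (hK : 0 ≤ K) (hε : 0 ≤ ε) (hx : 0 ≤ x)
    (h : ℝ) : gronwallBound δ K ε x + (K * gronwallBound δ K ε x + ε) * h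
      ≤ gronwallBound δ K ε (x + h) := by
  have hG : 0 ≤ gronwallBound δ K ε x :=
    hδ.trans ((gronwallBound_x0 δ K ε).ge.trans (gronwallBound_mono hδ hε hK hx))
  rcases hK.eq_or_lt with rfl | hK
  · simp only [gronwallBound_K0]
    linarith
  have hstep : gronwallBound δ K ε (x + h)
      = gronwallBound δ K ε x * Real.exp (K * h) + ε / K * (Real.exp (K * h) - 1) := by
    simp only [gronwallBound_of_K_ne_0 hK.ne', mul_add, Real.exp_add]
    ring
  calc gronwallBound δ K ε x + (K * gronwallBound δ K ε x + ε) * h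
      = gronwallBound δ K ε x * (K * h + 1) + ε / K * (K * h + 1 - 1) := by field
    _ ≤ gronwallBound δ K ε x * Real.exp (K * h) + ε / K * (Real.exp (K * h) - 1) := by
        gcongr <;> exact Real.add_one_le_exp _
    _ = gronwallBound δ K ε (x + h) := hstep.symm

theorem gronwallBound_zero_mul (K c ε x : ℝ) :
    gronwallBound 0 K (c * ε) x = gronwallBound 0 K c x * ε := by
  by_cases hK : K = 0
  · simp only [hK, gronwallBound_K0]
    ring
  · simp only [gronwallBound_of_K_ne_0 hK]
    ring

theorem norm_apply_sigma_le {D : ι → ℝ} (ht : t ∈ E)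
    (hW : ∀ i, HasDeltaDeriv T E (fun s => W s i) (D i) t) :
    ‖W (sigma T t)‖ ≤ ‖W t‖ + ‖D‖ * mu T t := by
  have hσ : W (sigma T t) = W t + mu T t • D := by
    ext i
    simpa [mul_comm] using (hW i).apply_sigma ht
  have hμ : 0 ≤ mu T t := sub_nonneg.2 (le_sigma T t)
  rw [hσ, mul_comm, ← norm_smul_of_nonneg hμ]
  exact norm_add_le _ _

theorem eventually_norm_le {D : ι → ℝ} (ht : t ∈ E) (hσ : sigma T t = t)
    (hW : ∀ i, HasDeltaDeriv T E (fun s => W s i) (D i) t) {η : ℝ} (hη : 0 < η) :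
    ∀ᶠ s in 𝓝[E] t, ‖W s‖ ≤ ‖W t‖ + (‖D‖ + η) * |s - t| := by
  filter_upwards [eventually_all.2 fun i => (hW i).eventually_abs_sub_le ht hη] with s hs
  have hsub : ‖W s - W t‖ ≤ (‖D‖ + η) * |s - t| := by
    refine (pi_norm_le_iff_of_nonneg (by positivity)).2 fun i => (hs i).trans ?_
    rw [hσ, abs_sub_comm t s, ← add_mul]
    gcongr
    exact norm_le_pi_norm D i
  linarith [norm_sub_norm_le (W s) (W t)]

theorem norm_le_gronwallBound_of_lt (hT : IsClosed T) (ha : a ∈ T) (hE : interval T a b ⊆ E)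
    {D : ℝ → ι → ℝ} {δ K ε ε' : ℝ} (hK : 0 ≤ K) (hε : 0 ≤ ε) (hεε' : ε < ε')
    (hW : ∀ t ∈ interval T a b, ∀ i, HasDeltaDeriv T E (fun s => W s i) (D t i) t)
    (h0 : ‖W a‖ ≤ δ) (hD : ∀ t ∈ interval T a b, ‖D t‖ ≤ K * ‖W t‖ + ε) :
    ∀ t ∈ interval T a b, ‖W t‖ ≤ gronwallBound δ K ε' (t - a) := by
  have hδ : 0 ≤ δ := (norm_nonneg _).trans h0
  have hstep : ∀ t ∈ interval T a b, ‖W t‖ ≤ gronwallBound δ K ε' (t - a) → ∀ s ≥ t,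
      ‖W t‖ + (‖D t‖ + (ε' - ε)) * (s - t) ≤ gronwallBound δ K ε' (s - a) := by
    intro t ht hPt s hts
    calc ‖W t‖ + (‖D t‖ + (ε' - ε)) * (s - t)
        ≤ gronwallBound δ K ε' (t - a)
          + (K * gronwallBound δ K ε' (t - a) + ε') * (s - t) := by
          refine add_le_add hPt (mul_le_mul_of_nonneg_right ?_ (sub_nonneg.2 hts))
          linarith [hD t ht, mul_le_mul_of_nonneg_left hPt hK]
      _ ≤ gronwallBound δ K ε' (t - a + (s - t)) :=
          gronwallBound_add_le hδ hK (hε.trans hεε'.le) (sub_nonneg.2 ht.2.1) _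
      _ = gronwallBound δ K ε' (s - a) := by ring_nf
  refine interval_induction hT ha ?_ ?_ ?_ ?_
  · rwa [sub_self, gronwallBound_x0]
  · intro t ht hσ hP
    have hmul := mul_nonneg (sub_nonneg.2 hεε'.le) (sub_nonneg.2 hσ.le)
    have hjump : ‖W (sigma T t)‖ ≤ ‖W t‖ + ‖D t‖ * (sigma T t - t) :=
      norm_apply_sigma_le (hE ht) (hW t ht)
    linarith [hstep t ht hP _ hσ.le]
  · intro t ht hσ hP
    have hsub : interval T a b ∩ Ioi t ⊆ E := inter_subset_left.trans hE
    filter_upwards [self_mem_nhdsWithin, nhdsWithin_mono t hsub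
      (eventually_norm_le (hE ht) hσ (hW t ht) (sub_pos.2 hεε'))] with s hst hs
    rw [abs_of_pos (sub_pos.2 hst.2)] at hs
    exact hs.trans (hstep t ht hP s hst.2.le)
  · intro t ht hl hP
    have hcont : ContinuousWithinAt W (interval T a b ∩ Iio t) t :=
      (continuousWithinAt_pi.2 fun i => (hW t ht i).continuousWithinAt (hE ht)).mono
        (inter_subset_left.trans hE)
    refine hcont.norm.closure_le hl (Continuous.continuousWithinAt ?_) hP
    exact (continuous_iff_continuousAt.2 fun x =>
      (hasDerivAt_gronwallBound δ K ε' x).continuousAt).comp (continuous_sub_right a)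

theorem norm_le_gronwallBound (hT : IsClosed T) (ha : a ∈ T) (hE : interval T a b ⊆ E)
    {D : ℝ → ι → ℝ} {δ K ε : ℝ} (hK : 0 ≤ K) (hε : 0 ≤ ε)
    (hW : ∀ t ∈ interval T a b, ∀ i, HasDeltaDeriv T E (fun s => W s i) (D t i) t)
    (h0 : ‖W a‖ ≤ δ) (hD : ∀ t ∈ interval T a b, ‖D t‖ ≤ K * ‖W t‖ + ε) :
    ∀ t ∈ interval T a b, ‖W t‖ ≤ gronwallBound δ K ε (t - a) := fun t ht =>
  ge_of_tendsto (x := 𝓝[>] ε)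
    ((gronwallBound_continuous_ε δ K (t - a)).continuousWithinAt.tendsto)
    (eventually_mem_nhdsWithin.mono fun _ hε' =>
      norm_le_gronwallBound_of_lt hT ha hE hK hε hε' hW h0 hD t ht)

end Gronwall

section DeltaIntegral

variable {T : Set ℝ} {a d s t r : ℝ}

/-- The last point of the time scale `T` that does not exceed `s`. -/
def lastPoint (T : Set ℝ) (s : ℝ) : ℝ := sSup (T ∩ Iic s)

theorem bddAbove_inter_Iic (T : Set ℝ) (s : ℝ) : BddAbove (T ∩ Iic s) :=
  bddAbove_Iic.mono inter_subset_right

theorem le_lastPoint (hr : r ∈ T) (hrs : r ≤ s) : r ≤ lastPoint T s :=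
  le_csSup (bddAbove_inter_Iic T s) ⟨hr, hrs⟩

theorem lastPoint_mem (hT : IsClosed T) (ha : a ∈ T) (has : a ≤ s) :
    lastPoint T s ∈ interval T a s :=
  have h := (hT.inter isClosed_Iic).csSup_mem ⟨a, ha, has⟩ (bddAbove_inter_Iic T s)
  ⟨h.1, le_lastPoint ha has, h.2⟩

theorem lastPoint_mem_uIcc (hT : IsClosed T) (hs : s ∈ T) (ht : t ∈ T) (hr : r ∈ uIcc s t) :
    lastPoint T r ∈ T ∩ uIcc s t :=
  have hmin : min s t ∈ T := by rcases min_choice s t with h | h <;> rwa [h]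
  have h := lastPoint_mem hT hmin hr.1
  ⟨h.1, h.2.1, h.2.2.trans hr.2⟩

theorem lastPoint_eq_of_lt_sigma (hT : IsClosed T) (ht : t ∈ T) (hts : t ≤ s)
    (hs : s < sigma T t) : lastPoint T s = t :=
  have h := lastPoint_mem hT ht hts
  (le_of_lt_sigma h.1 (h.2.2.trans_lt hs)).antisymm h.2.1

theorem monotoneOn_lastPoint (hT : IsClosed T) (ha : a ∈ T) : MonotoneOn (lastPoint T) (Ici a) :=
  fun _ hr _ _ hrs => have h := lastPoint_mem hT ha hr; le_lastPoint h.1 (h.2.2.trans hrs)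

theorem countable_setOf_lt_sigma (T : Set ℝ) : {t ∈ T | t < sigma T t}.Countable := by
  refine PairwiseDisjoint.countable_of_Ioo (y := sigma T) ?_ fun t ht => ht.2
  intro t ht s hs hts
  refine disjoint_left.2 fun q hqt hqs => hts (le_antisymm ?_ ?_)
  · exact le_of_lt_sigma ht.1 (hqt.1.trans hqs.2)
  · exact le_of_lt_sigma hs.1 (hqs.1.trans hqt.2)

variable {V : Type*} [NormedAddCommGroup V] {h : ℝ → V}

/-- Boundedness on `S ⊆ T` together with continuity at the points fixed by `σ`: the regularity
that the delta integral needs of its integrand. -/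
def RdBddOn (T S : Set ℝ) (h : ℝ → V) : Prop :=
  (∃ B, ∀ t ∈ S, ‖h t‖ ≤ B) ∧ ∀ t ∈ S, sigma T t = t → ContinuousWithinAt h S t

theorem RdBddOn.pi {S : Set ℝ} {ι : Type*} [Fintype ι] {h : ℝ → ι → ℝ}
    (hh : ∀ i, RdBddOn T S fun t => h t i) : RdBddOn T S h := by
  choose B hB using fun i => (hh i).1
  refine ⟨⟨‖B‖, fun t ht => (pi_norm_le_iff_of_nonneg (norm_nonneg B)).2 fun i => ?_⟩,
    fun t ht hσ => continuousWithinAt_pi.2 fun i => (hh i).2 t ht hσ⟩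
  exact (hB i t ht).trans ((le_abs_self _).trans (norm_le_pi_norm B i))

theorem RdBddOn.apply {S : Set ℝ} {ι : Type*} [Fintype ι] {h : ℝ → ι → ℝ} (hh : RdBddOn T S h)
    (i : ι) : RdBddOn T S fun t => h t i :=
  ⟨hh.1.imp fun _ hB t ht => (norm_le_pi_norm (h t) i).trans (hB t ht),
    fun t ht hσ => continuousWithinAt_pi.1 (hh.2 t ht hσ) i⟩

section Measurability

variable [MeasurableSpace V] [BorelSpace V]

theorem RdBddOn.measurable_indicator (hT : IsClosed T) (hh : RdBddOn T (interval T a d) h) :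
    Measurable ((interval T a d).indicator h) := by
  set E := interval T a d
  set N := {t ∈ T | t < sigma T t}
  have hN : N.Countable := countable_setOf_lt_sigma T
  have hcont : ContinuousOn h (E \ N) := fun t ht =>
    (hh.2 t ht.1 ((le_sigma T t).eq_or_lt.resolve_right fun hσ => ht.2 ⟨ht.1.1, hσ⟩).symm).mono
      sdiff_subset
  have hmeas : Measurable ((E \ N).indicator h) := by
    classical
    rw [← piecewise_eq_indicator]
    exact hcont.measurable_piecewise continuousOn_const
      ((isCompact_interval hT a d).measurableSet.diff hN.measurableSet)
  refine hmeas.measurable_of_countable_ne (hN.mono fun t ht => ?_)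
  by_contra htN
  refine ht ?_
  by_cases htE : t ∈ E
  · rw [indicator_of_mem (show t ∈ E \ N from ⟨htE, htN⟩), indicator_of_mem htE]
  · rw [indicator_of_notMem fun hm => htE hm.1, indicator_of_notMem htE]

variable [SecondCountableTopology V]

theorem RdBddOn.intervalIntegrable (hT : IsClosed T) (ha : a ∈ T)
    (hh : RdBddOn T (interval T a d) h) (hs : s ∈ Icc a d) (hr : r ∈ Icc a d) :
    IntervalIntegrable (fun q => h (lastPoint T q)) volume s r := by
  have hmem : ∀ q ∈ Icc a d, lastPoint T q ∈ interval T a d := fun q hq =>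
    interval_subset_interval hq.2 (lastPoint_mem hT ha hq.1)
  have hmeas : AEMeasurable (fun q => h (lastPoint T q)) (volume.restrict (Icc a d)) := by
    have hlast : AEMeasurable (lastPoint T) (volume.restrict (Icc a d)) :=
      aemeasurable_restrict_of_monotoneOn measurableSet_Icc
        ((monotoneOn_lastPoint hT ha).mono Icc_subset_Ici_self)
    refine ((hh.measurable_indicator hT).comp_aemeasurable hlast).congr ?_
    filter_upwards [ae_restrict_mem measurableSet_Icc] with q hq
    exact indicator_of_mem (hmem q hq) h
  obtain ⟨B, hB⟩ := hh.1
  have hint : IntegrableOn (fun q => h (lastPoint T q)) (Icc a d) :=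
    IntegrableOn.of_bound measure_Icc_lt_top hmeas.aestronglyMeasurable B
      ((ae_restrict_mem measurableSet_Icc).mono fun q hq => hB _ (hmem q hq))
  exact (hint.mono_set (uIcc_subset_Icc hs hr)).intervalIntegrable

end Measurability

variable [NormedSpace ℝ V]

/-- The delta integral `∫_a^t h Δs`: on each gap of `T` the integrand is extended by its value at
the left endpoint of the gap. -/
def deltaIntegral (T : Set ℝ) (h : ℝ → V) (a t : ℝ) : V := ∫ s in a..t, h (lastPoint T s)

theorem deltaIntegral_sigma_sub (hT : IsClosed T) (ha : a ∈ T) {h : ℝ → ℝ}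
    (hh : RdBddOn T (interval T a d) h) (hs : s ∈ Icc a d) (ht : t ∈ interval T a d)
    (hσ : sigma T t ≤ d) :
    deltaIntegral T h a (sigma T t) - deltaIntegral T h a s - h t * (sigma T t - s)
      = ∫ q in s..t, (h (lastPoint T q) - h t) := by
  have hint {p r : ℝ} (hp : p ∈ Icc a d) (hr : r ∈ Icc a d) :=
    hh.intervalIntegrable hT ha hp hr
  have hσ' : sigma T t ∈ Icc a d := ⟨ht.2.1.trans (le_sigma T t), hσ⟩
  have ha' : a ∈ Icc a d := ⟨le_rfl, hs.1.trans hs.2⟩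
  have hgap : ∫ q in t..sigma T t, h (lastPoint T q) = h t * (sigma T t - t) := by
    rw [intervalIntegral.integral_congr_Ioo_of_le (g := fun _ => h t) (le_sigma T t)]
    · simp [mul_comm]
    · intro q hq
      simp only [lastPoint_eq_of_lt_sigma hT ht.1 hq.1.le hq.2]
  rw [deltaIntegral, deltaIntegral, intervalIntegral.integral_interval_sub_left
    (hint ha' hσ') (hint ha' hs), ← intervalIntegral.integral_add_adjacent_intervals
    (hint hs ht.2) (hint ht.2 hσ'), hgap, intervalIntegral.integral_sub (hint hs ht.2)
    intervalIntegrable_const, intervalIntegral.integral_const, smul_eq_mul]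
  ring

theorem hasDeltaDeriv_deltaIntegral (hT : IsClosed T) (ha : a ∈ T) {h : ℝ → ℝ}
    (hh : RdBddOn T (interval T a d) h) (ht : t ∈ interval T a d) (hσ : sigma T t ≤ d) :
    HasDeltaDeriv T (interval T a d) (deltaIntegral T h a) (h t) t := by
  intro ε hε
  have hmem : ∀ s ∈ interval T a d, ∀ q ∈ uIoc s t,
      lastPoint T q ∈ interval T a d ∩ uIcc s t := fun s hs q hq =>
    have hq := lastPoint_mem_uIcc hT hs.1 ht.1 (uIoc_subset_uIcc hq)
    ⟨⟨hq.1, uIcc_subset_Icc hs.2 ht.2 hq.2⟩, hq.2⟩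
  suffices ∀ᶠ s in 𝓝[interval T a d] t,
      ‖∫ q in s..t, (h (lastPoint T q) - h t)‖ ≤ ε * |sigma T t - s| by
    filter_upwards [this, self_mem_nhdsWithin] with s hs hsE
    rwa [deltaIntegral_sigma_sub hT ha hh hsE.2 ht hσ]
  rcases (le_sigma T t).eq_or_lt with hσt | hσt
  · obtain ⟨δ, hδ, hδε⟩ :=
      Metric.continuousWithinAt_iff.1 (hh.2 t ht hσt.symm) ε hε
    filter_upwards [self_mem_nhdsWithin, nhdsWithin_le_nhds (Metric.ball_mem_nhds t hδ)]
      with s hs hst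
    rw [← hσt]
    refine intervalIntegral.norm_integral_le_of_norm_le_const fun q hq => ?_
    have hq := hmem s hs q hq
    exact (hδε hq.1 ((Real.dist_right_le_of_mem_uIcc hq.2).trans_lt hst)).le
  · obtain ⟨B, hB⟩ := hh.1
    have hlim : ContinuousAt (fun s => 2 * B * |t - s|) t := by fun_prop
    have hsmall := hlim.eventually_lt_const (u := ε * mu T t) (by
      simpa [mu] using mul_pos hε (sub_pos.2 hσt))
    filter_upwards [self_mem_nhdsWithin, eventually_le_of_lt_sigma inter_subset_left hσt,
      nhdsWithin_le_nhds hsmall] with s hs hst hsε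
    have hbound : ∀ q ∈ uIoc s t, ‖h (lastPoint T q) - h t‖ ≤ 2 * B := fun q hq =>
      calc ‖h (lastPoint T q) - h t‖ ≤ B + B :=
            (norm_sub_le _ _).trans (add_le_add (hB _ (hmem s hs q hq).1) (hB t ht))
        _ = 2 * B := by ring
    calc _ ≤ 2 * B * |t - s| := intervalIntegral.norm_integral_le_of_norm_le_const hbound
      _ ≤ ε * mu T t := hsε.le
      _ ≤ ε * |sigma T t - s| := by
        gcongr
        exact (sub_le_sub_left hst _).trans (le_abs_self _)

end DeltaIntegral

section Picard

open scoped Nat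

variable {T : Set ℝ} {a d t : ℝ} {V : Type*} [NormedAddCommGroup V]

/-- The hypotheses of the Picard-Lindelöf theorem for `Y^Δ(t) = F(t, Y(t))` on `[a, d]_T`:
`F(t, ·)` is Lipschitz uniformly in `t`, and the right-hand side is delta integrable along every
continuous curve. -/
structure IsRdLipschitz (T : Set ℝ) (a d : ℝ) (F : ℝ → V → V) (K : ℝ≥0) : Prop where
  lipschitzWith : ∀ t ∈ interval T a d, LipschitzWith K (F t)
  rdBddOn : ∀ Z : ℝ → V, Continuous Z → RdBddOn T (interval T a d) fun t => F t (Z t)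

variable [MeasurableSpace V] [BorelSpace V] [SecondCountableTopology V] [NormedSpace ℝ V]
  {F : ℝ → V → V} {K : ℝ≥0}

theorem RdBddOn.continuousOn_deltaIntegral (hT : IsClosed T) (ha : a ∈ T) (had : a ≤ d)
    {h : ℝ → V} (hh : RdBddOn T (interval T a d) h) :
    ContinuousOn (deltaIntegral T h a) (Icc a d) := by
  rw [← uIcc_of_le had]
  exact intervalIntegral.continuousOn_primitive_interval'
    (hh.intervalIntegrable hT ha ⟨le_rfl, had⟩ ⟨had, le_rfl⟩) left_mem_uIcc

/-- The Picard operator `Z ↦ z₀ + ∫_a^t F(s, Z(s)) Δs`. The curves live on the real interval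
`[a, d]`, where the delta integral interpolates between the points of `T`. -/
def picardMap (hT : IsClosed T) (ha : a ∈ T) (had : a ≤ d) (hF : IsRdLipschitz T a d F K) (z₀ : V)
    (Z : C(Icc a d, V)) : C(Icc a d, V) where
  toFun t := z₀ + deltaIntegral T (fun s => F s (IccExtend had Z s)) a t
  continuous_toFun := continuous_const.add (continuousOn_iff_continuous_domRestrict.1
    ((hF.rdBddOn _ Z.continuous.Icc_extend').continuousOn_deltaIntegral hT ha had))

theorem norm_picardMap_sub_le (hT : IsClosed T) (ha : a ∈ T) (had : a ≤ d)
    (hF : IsRdLipschitz T a d F K) (z₀ : V) {Y Z : C(Icc a d, V)} {g : ℝ → ℝ} (hg : Continuous g)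
    (hg' : MonotoneOn g (Icc a d)) (hYZ : ∀ t : Icc a d, ‖Y t - Z t‖ ≤ g t) (t : Icc a d) :
    ‖picardMap hT ha had hF z₀ Y t - picardMap hT ha had hF z₀ Z t‖
      ≤ ∫ s in a..t, K * g s := by
  have hint (X : C(Icc a d, V)) :=
    (hF.rdBddOn (IccExtend had X) X.continuous.Icc_extend').intervalIntegrable hT ha
      ⟨le_rfl, had⟩ t.2
  simp only [picardMap, ContinuousMap.coe_mk, deltaIntegral, add_sub_add_left_eq_sub]
  rw [← intervalIntegral.integral_sub (hint Y) (hint Z)]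
  refine intervalIntegral.norm_integral_le_of_norm_le t.2.1 (ae_of_all _ fun s hs => ?_)
    ((continuous_const.mul hg).intervalIntegrable _ _)
  have hlast := lastPoint_mem hT ha hs.1.le
  have hsd : s ∈ Icc a d := ⟨hs.1.le, hs.2.trans t.2.2⟩
  have hlastd : lastPoint T s ∈ Icc a d := ⟨hlast.2.1, hlast.2.2.trans hsd.2⟩
  refine ((hF.lipschitzWith _ ⟨hlast.1, hlastd⟩).norm_sub_le _ _).trans ?_
  rw [IccExtend_of_mem had _ hlastd, IccExtend_of_mem had _ hlastd]
  gcongr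
  exact (hYZ ⟨_, hlastd⟩).trans (hg' hlastd hsd hlast.2.2)

theorem norm_iterate_picardMap_sub_le (hT : IsClosed T) (ha : a ∈ T) (had : a ≤ d)
    (hF : IsRdLipschitz T a d F K) (z₀ : V) (Y Z : C(Icc a d, V)) (m : ℕ) (t : Icc a d) :
    ‖(picardMap hT ha had hF z₀)^[m] Y t - (picardMap hT ha had hF z₀)^[m] Z t‖
      ≤ (K * (t - a)) ^ m / m ! * dist Y Z := by
  induction m generalizing t with
  | zero => simpa [← dist_eq_norm] using ContinuousMap.dist_apply_le_dist t
  | succ m ih =>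
    rw [Function.iterate_succ_apply', Function.iterate_succ_apply']
    have hmono : MonotoneOn (fun s : ℝ => (K * (s - a)) ^ m / m ! * dist Y Z) (Icc a d) := by
      intro r hr s _ hrs
      have hra := sub_nonneg.2 hr.1
      dsimp only
      gcongr
    refine (norm_picardMap_sub_le hT ha had hF z₀ (by fun_prop) hmono ih t).trans_eq ?_
    have hK : ∀ s : ℝ, K * ((K * (s - a)) ^ m / m ! * dist Y Z)
        = K ^ (m + 1) / m ! * dist Y Z * (s - a) ^ m := fun s => by rw [mul_pow]; ring
    have hpow : ∫ s in a..(t : ℝ), (s - a) ^ m = ((t : ℝ) - a) ^ (m + 1) / (m + 1) := by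
      simp [intervalIntegral.integral_comp_sub_right (fun s => s ^ m)]
    simp only [hK, intervalIntegral.integral_const_mul, hpow, Nat.factorial_succ, Nat.cast_mul,
      Nat.cast_succ]
    rw [mul_pow]
    field

theorem exists_contractingWith_iterate_picardMap (hT : IsClosed T) (ha : a ∈ T) (had : a ≤ d)
    (hF : IsRdLipschitz T a d F K) (z₀ : V) :
    ∃ m, ContractingWith 2⁻¹ (picardMap hT ha had hF z₀)^[m] := by
  have hlim := FloorSemiring.tendsto_pow_div_factorial_atTop (K * (d - a))
  obtain ⟨m, hm⟩ := (hlim.eventually_le_const (u := (2⁻¹ : ℝ)) (by norm_num)).exists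
  refine ⟨m, by norm_num [inv_lt_one_of_one_lt₀], LipschitzWith.of_dist_le_mul fun Y Z => ?_⟩
  refine (ContinuousMap.dist_le (by positivity)).2 fun t => ?_
  rw [dist_eq_norm]
  refine (norm_iterate_picardMap_sub_le hT ha had hF z₀ Y Z m t).trans ?_
  have hta := sub_nonneg.2 t.2.1
  gcongr
  calc (K * ((t : ℝ) - a)) ^ m / m ! ≤ (K * (d - a)) ^ m / m ! := by gcongr; exact t.2.2
    _ ≤ ((2⁻¹ : ℝ≥0) : ℝ) := by simpa using hm

theorem IsRdLipschitz.exists_eq_add_deltaIntegral [CompleteSpace V] (hT : IsClosed T) (ha : a ∈ T)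
    (had : a ≤ d) (hF : IsRdLipschitz T a d F K) (z₀ : V) :
    ∃ Z : ℝ → V, Continuous Z ∧
      ∀ t ∈ Icc a d, Z t = z₀ + deltaIntegral T (fun s => F s (Z s)) a t := by
  obtain ⟨m, hm⟩ := exists_contractingWith_iterate_picardMap hT ha had hF z₀
  have hfix := hm.isFixedPt_fixedPoint_iterate
  set Z := ContractingWith.fixedPoint _ hm
  refine ⟨IccExtend had Z, Z.continuous.Icc_extend', fun t ht => ?_⟩
  rw [IccExtend_of_mem had _ ht]
  exact (DFunLike.congr_fun hfix ⟨t, ht⟩).symm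

end Picard

section RdContinuous

variable {T S S' : Set ℝ} {g h : ℝ → ℝ}

theorem RdContinuousOn.mono (hg : RdContinuousOn T S g) (hS : S' ⊆ S) :
    RdContinuousOn T S' g :=
  have hlt (t : ℝ) : S' ∩ Iio t ⊆ S ∩ Iio t := inter_subset_inter_left _ hS
  ⟨fun t ht hσ => (hg.1 t (hS ht) hσ).mono hS, fun t ht hl =>
    (hg.2 t (hS ht) (closure_mono (hlt t) hl)).imp fun _ h =>
      h.mono_left (nhdsWithin_mono t (hlt t))⟩

theorem RdContinuousOn.congr (hg : RdContinuousOn T S g) (hgh : EqOn h g S) :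
    RdContinuousOn T S h :=
  ⟨fun t ht hσ => (hg.1 t ht hσ).congr hgh (hgh ht), fun t ht hl =>
    (hg.2 t ht hl).imp fun _ h => (tendsto_congr' (eventually_nhdsWithin_of_forall
      fun _ hs => hgh hs.1)).2 h⟩

theorem RdContinuousOn.comp₂ {ψ : ℝ × ℝ → ℝ} (hψ : Continuous ψ) (hg : RdContinuousOn T S g)
    (hh : RdContinuousOn T S h) : RdContinuousOn T S fun t => ψ (g t, h t) := by
  refine ⟨fun t ht hσ => hψ.continuousAt.comp_continuousWithinAt
    ((hg.1 t ht hσ).prodMk (hh.1 t ht hσ)), fun t ht hl => ?_⟩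
  obtain ⟨p, hp⟩ := hg.2 t ht hl
  obtain ⟨q, hq⟩ := hh.2 t ht hl
  exact ⟨ψ (p, q), (hψ.tendsto (p, q)).comp (hp.prodMk_nhds hq)⟩

theorem rdContinuousOn_of_continuous (hg : Continuous g) : RdContinuousOn T S g :=
  ⟨fun _ _ _ => hg.continuousWithinAt, fun t _ _ => ⟨g t, hg.continuousWithinAt⟩⟩

theorem RdContinuousOn.exists_abs_le (hg : RdContinuousOn T S g) (hS : IsCompact S)
    (hST : S ⊆ T) : ∃ B, ∀ t ∈ S, |g t| ≤ B := by
  refine hS.induction_on (p := fun U => ∃ B, ∀ t ∈ U, |g t| ≤ B) ⟨0, by simp⟩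
    (fun U U' hU ⟨B, hB⟩ => ⟨B, fun t ht => hB t (hU ht)⟩)
    (fun U U' ⟨B, hB⟩ ⟨B', hB'⟩ => ⟨max B B', fun t ht => le_max_iff.2 (ht.imp (hB t) (hB' t))⟩)
    fun t ht => ?_
  rcases (le_sigma T t).eq_or_lt with hσ | hσ
  · exact ⟨{s | |g s| ≤ |g t| + 1},
      (hg.1 t ht hσ.symm).abs.eventually_le_const (lt_add_one _), _, fun _ hs => hs⟩
  have hlim : ∃ l, Tendsto g (𝓝[S ∩ Iio t] t) (𝓝 l) := by
    by_cases hl : t ∈ closure (S ∩ Iio t)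
    · exact hg.2 t ht hl
    · rw [mem_closure_iff_nhdsWithin_neBot, not_neBot] at hl
      exact ⟨0, hl ▸ tendsto_bot⟩
  obtain ⟨l, hl⟩ := hlim
  have hleft := eventually_nhdsWithin_iff.1 (hl.abs.eventually_le_const (lt_add_one |l|))
  refine ⟨{s | |g s| ≤ max (|l| + 1) |g t|}, ?_, _, fun _ hs => hs⟩
  filter_upwards [nhdsWithin_le_nhds hleft, eventually_le_of_lt_sigma hST hσ, self_mem_nhdsWithin]
    with s hs hst hsS
  rcases hst.lt_or_eq with hst | rfl
  · exact (hs ⟨hsS, hst⟩).trans (le_max_left _ _)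
  · exact le_max_right _ _

theorem RdContinuousOn.rdBddOn (hg : RdContinuousOn T S g) (hS : IsCompact S) (hST : S ⊆ T) :
    RdBddOn T S g :=
  ⟨hg.exists_abs_le hS hST, hg.1⟩

/-- The function `v ↦ 1 / v`, cut off at `|v| = c` to become continuous. -/
def cutoffInv (c v : ℝ) : ℝ := v / max (v ^ 2) (c ^ 2)

theorem continuous_cutoffInv {c : ℝ} (hc : c ≠ 0) : Continuous (cutoffInv c) :=
  continuous_id.div (by fun_prop) fun _ => (lt_max_of_lt_right (by positivity)).ne'

theorem abs_cutoffInv_le {c : ℝ} (hc : 0 < c) (v : ℝ) : |cutoffInv c v| ≤ c⁻¹ := by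
  have hmax : |v| * c ≤ max (v ^ 2) (c ^ 2) := by
    rcases le_total |v| c with h | h
    · exact le_max_of_le_right ((mul_le_mul_of_nonneg_right h hc.le).trans_eq (sq c).symm)
    · refine le_max_of_le_left ((mul_le_mul_of_nonneg_left h (abs_nonneg v)).trans_eq ?_)
      rw [← sq, sq_abs]
  have hpos : 0 < max (v ^ 2) (c ^ 2) := lt_max_of_lt_right (by positivity)
  rwa [cutoffInv, abs_div, abs_of_pos hpos, div_le_iff₀ hpos, inv_mul_eq_div, le_div_iff₀ hc]

theorem mul_cutoffInv_cancel {c v : ℝ} (hc : 0 < c) (hv : c ≤ |v|) : v * cutoffInv c v = 1 := by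
  have hv0 : v ≠ 0 := abs_pos.1 (hc.trans_le hv)
  have hsq : c ^ 2 ≤ v ^ 2 := sq_abs v ▸ pow_le_pow_left₀ hc.le hv 2
  rw [cutoffInv, max_eq_left hsq]
  field

end RdContinuous

section System

variable {T : Set ℝ} {a d : ℝ} {ι : Type*} [Fintype ι] {F : ℝ → (ι → ℝ) → ι → ℝ} {K : ℝ≥0}

theorem IsRdLipschitz.exists_hasDeltaDeriv (hT : IsClosed T) (ha : a ∈ T) (had : a ≤ d)
    (hF : IsRdLipschitz T a d F K) (z₀ : ι → ℝ) :
    ∃ Y : ℝ → ι → ℝ, Continuous Y ∧ Y a = z₀ ∧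
      ∀ t ∈ interval T a d, sigma T t ≤ d → ∀ i,
        HasDeltaDeriv T (interval T a d) (fun s => Y s i) (F t (Y t) i) t := by
  obtain ⟨Y, hY, hYint⟩ := hF.exists_eq_add_deltaIntegral hT ha had z₀
  have hrd := hF.rdBddOn Y hY
  have hcoord (i : ι) (t : ℝ) (ht : t ∈ Icc a d) :
      Y t i = z₀ i + deltaIntegral T (fun s => F s (Y s) i) a t := by
    rw [hYint t ht, Pi.add_apply]
    exact congrArg _ ((ContinuousLinearMap.proj (R := ℝ) (φ := fun _ : ι => ℝ) i)
      |>.intervalIntegral_comp_comm (hrd.intervalIntegrable hT ha ⟨le_rfl, had⟩ ht)).symm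
  refine ⟨Y, hY, ?_, fun t ht hσ i => ?_⟩
  · rw [hYint a ⟨le_rfl, had⟩, deltaIntegral, intervalIntegral.integral_same, add_zero]
  · refine ((hasDeltaDeriv_deltaIntegral hT ha (hrd.apply i) ht hσ).const_add (z₀ i)).congr ?_ ?_
    · exact eventually_nhdsWithin_of_forall fun s hs => hcoord i s hs.2
    · exact hcoord i _ ⟨ht.2.1.trans (le_sigma T t), hσ⟩

end System

section Jet

variable {n : ℕ} {α : ℕ → ℝ}

/-- The values `M_0 y, …, M_n y` of a function with `∑_{k ≤ n} α_k M_k y = c` (where `α_n = 1`),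
recovered from `z = (M_0 y, …, M_{n-1} y)`; all indices beyond `n` are given the value at `n`. -/
def jet (α : ℕ → ℝ) (c : ℝ) (z : Fin n → ℝ) (k : ℕ) : ℝ :=
  if h : k < n then z ⟨k, h⟩ else c - ∑ i : Fin n, α i * z i

theorem jet_of_lt (α : ℕ → ℝ) (c : ℝ) (z : Fin n → ℝ) {k : ℕ} (hk : k < n) :
    jet α c z k = z ⟨k, hk⟩ :=
  dif_pos hk

theorem jet_self (α : ℕ → ℝ) (c : ℝ) (z : Fin n → ℝ) :
    jet α c z n = c - ∑ i : Fin n, α i * z i :=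
  dif_neg (lt_irrefl n)

theorem sum_mul_jet (hα : α n = 1) (c : ℝ) (z : Fin n → ℝ) :
    ∑ k ∈ Finset.range (n + 1), α k * jet α c z k = c := by
  rw [Finset.sum_range_succ, hα, one_mul, jet_self, Finset.sum_range]
  simp only [jet_of_lt α c z (Fin.is_lt _), Fin.eta, add_sub_cancel]

theorem jet_sum_mul (hα : α n = 1) (m : ℕ → ℝ) {k : ℕ} (hk : k ≤ n) :
    jet α (∑ i ∈ Finset.range (n + 1), α i * m i) (fun i : Fin n => m i) k = m k := by
  rcases hk.lt_or_eq with hk | rfl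
  · exact jet_of_lt _ _ _ hk
  · rw [jet_self, Finset.sum_range_succ, hα, one_mul, Finset.sum_range, add_sub_cancel_left]

theorem jet_sub_jet (α : ℕ → ℝ) (c c' : ℝ) (z z' : Fin n → ℝ) (k : ℕ) :
    jet α c z k - jet α c' z' k = jet α (c - c') (z - z') k := by
  unfold jet
  split_ifs
  · rfl
  · simp only [Pi.sub_apply, mul_sub, Finset.sum_sub_distrib]
    ring

theorem abs_jet_le (α : ℕ → ℝ) (c : ℝ) (z : Fin n → ℝ) (k : ℕ) :
    |jet α c z k| ≤ |c| + (1 + ∑ i : Fin n, |α i|) * ‖z‖ := by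
  have hcoord (i : Fin n) : |z i| ≤ ‖z‖ := norm_le_pi_norm z i
  rw [one_add_mul, Finset.sum_mul]
  unfold jet
  split_ifs with hk
  · have hsum : 0 ≤ ∑ i : Fin n, |α i| * ‖z‖ := by positivity
    linarith [hcoord ⟨k, hk⟩, abs_nonneg c]
  · have hsum : |∑ i : Fin n, α i * z i| ≤ ∑ i : Fin n, |α i| * ‖z‖ :=
      (Finset.abs_sum_le_sum_abs _ _).trans (Finset.sum_le_sum fun i _ => by
        rw [abs_mul]; gcongr; exact hcoord i)
    linarith [abs_sub c (∑ i : Fin n, α i * z i), norm_nonneg z]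

variable {T : Set ℝ} {a d : ℝ} {f w : ℝ → ℝ}

theorem RdContinuousOn.jet {S : Set ℝ} (hf : RdContinuousOn T S f) {Y : ℝ → Fin n → ℝ}
    (hY : Continuous Y) (α : ℕ → ℝ) (k : ℕ) :
    RdContinuousOn T S fun t => jet α (f t) (Y t) k := by
  unfold TimeScale.jet
  split_ifs
  · exact rdContinuousOn_of_continuous (by fun_prop)
  · have hsum : Continuous fun t => ∑ i : Fin n, α i * Y t i := by fun_prop
    exact hf.comp₂ continuous_sub (rdContinuousOn_of_continuous hsum)

theorem isRdLipschitz_jet (hT : IsClosed T) (hf : RdContinuousOn T (interval T a d) f)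
    (hw : RdContinuousOn T (interval T a d) w) {B : ℝ≥0}
    (hB : ∀ t ∈ interval T a d, |w t| ≤ B) :
    IsRdLipschitz T a d (fun t (z : Fin n → ℝ) i => w t * jet α (f t) z (i + 1))
      (B * (1 + ∑ i : Fin n, ‖α i‖₊)) where
  lipschitzWith t ht := LipschitzWith.of_dist_le_mul fun z z' => by
    rw [dist_eq_norm, dist_eq_norm, pi_norm_le_iff_of_nonneg (by positivity)]
    intro i
    have hjet := abs_jet_le α 0 (z - z') (i + 1)
    rw [abs_zero, zero_add] at hjet
    calc ‖w t * jet α (f t) z (i + 1) - w t * jet α (f t) z' (i + 1)‖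
        = |w t| * |jet α 0 (z - z') (i + 1)| := by
          rw [← mul_sub, jet_sub_jet, sub_self, Real.norm_eq_abs, abs_mul]
      _ ≤ B * ((1 + ∑ i : Fin n, |α i|) * ‖z - z'‖) := by
          gcongr
          exact hB t ht
      _ = _ := by simp [mul_assoc]
  rdBddOn Z hZ := RdBddOn.pi fun i =>
    (hw.comp₂ continuous_mul (hf.jet hZ α (i + 1))).rdBddOn (isCompact_interval hT a d)
      inter_subset_left

end Jet

section Chain

variable {T E S : Set ℝ} {a b c d t r A : ℝ} {φ w f x : ℝ → ℝ} {n : ℕ} {α : ℕ → ℝ}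
  {m m' : ℕ → ℝ → ℝ}

/-- The functions `m 0, …, m n` form a chain on `S` if `(m k)^Δ = w · m (k + 1)` there. For
`w = 1 / φ` this is the relation between the functions `M_0 y, …, M_n y`. -/
def IsDeltaChain (T E : Set ℝ) (w : ℝ → ℝ) (n : ℕ) (m : ℕ → ℝ → ℝ) (S : Set ℝ) : Prop :=
  ∀ k < n, ∀ t ∈ S, HasDeltaDeriv T E (m k) (w t * m (k + 1) t) t

theorem IsDeltaChain.sub (h : IsDeltaChain T E w n m S) (h' : IsDeltaChain T E w n m' S) :
    IsDeltaChain T E w n (fun k t => m k t - m' k t) S := fun k hk t ht => by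
  rw [mul_sub]
  exact (h k hk t ht).sub (h' k hk t ht)

theorem M_succ (T E : Set ℝ) (φ y : ℝ → ℝ) (k : ℕ) (t : ℝ) :
    M T E φ (k + 1) y t = φ t * deltaDeriv T E (M T E φ k y) t :=
  rfl

theorem mul_M_succ {k : ℕ} (hw : φ t * w t = 1) :
    w t * M T E φ (k + 1) x t = deltaDeriv T E (M T E φ k x) t := by
  rw [M_succ, ← mul_assoc, mul_comm (w t), hw, one_mul]

theorem isDeltaChain_M (hx : ∀ k < n, ∀ t ∈ S, ∃ D, HasDeltaDeriv T E (M T E φ k x) D t)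
    (hw : ∀ t ∈ S, φ t * w t = 1) : IsDeltaChain T E w n (fun k => M T E φ k x) S :=
  fun k hk t ht => by
    rw [mul_M_succ (hw t ht)]
    exact deltaDeriv_spec (hx k hk t ht)

theorem exists_isDeltaChain (hT : IsClosed T) (ha : a ∈ T) (had : a ≤ d)
    (hf : RdContinuousOn T (interval T a d) f) (hw : RdContinuousOn T (interval T a d) w)
    (hα : α n = 1) (z₀ : ℕ → ℝ) :
    ∃ Z : ℕ → ℝ → ℝ, IsDeltaChain T (interval T a d) w n Z {t ∈ interval T a d | sigma T t ≤ d} ∧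
      (∀ k, RdContinuousOn T (interval T a d) (Z k)) ∧
      (∀ t, ∑ k ∈ Finset.range (n + 1), α k * Z k t = f t) ∧ ∀ k < n, Z k a = z₀ k := by
  obtain ⟨B, hB⟩ := hw.exists_abs_le (isCompact_interval hT a d) inter_subset_left
  have hLip := isRdLipschitz_jet (n := n) (α := α) (B := B.toNNReal) hT hf hw fun t ht =>
    (hB t ht).trans (Real.le_coe_toNNReal B)
  obtain ⟨Y, hY, hYa, hYd⟩ := hLip.exists_hasDeltaDeriv hT ha had fun i => z₀ i
  refine ⟨fun k t => jet α (f t) (Y t) k, fun k hk t ht => ?_, fun k => hf.jet hY α k,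
    fun t => sum_mul_jet hα _ _, fun k hk => ?_⟩
  · simpa only [jet_of_lt _ _ _ hk] using hYd t ht.1 ht.2 ⟨k, hk⟩
  · simp only [jet_of_lt _ _ _ hk, hYa]

theorem mem_kappa_of_le (hc : c ∈ kappa (interval T a d)) (ht : t ∈ interval T a c) :
    t ∈ kappa (interval T a d) := by
  rcases ht.2.2.eq_or_lt with rfl | htc
  · exact hc
  · exact mem_kappa_of_lt ⟨ht.1, ht.2.1, htc.le.trans hc.1.2.2⟩ hc.1 htc

theorem RdContinuousOn.eventually_le_abs (hφ : RdContinuousOn T (interval T a d) φ) (hcd : c ≤ d)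
    (hφc : ∀ s ∈ interval T a c, A ≤ |φ s|) (hr : r < A) (ht : t ∈ interval T a c) :
    ∀ᶠ s in 𝓝[interval T a d] t, r ≤ |φ s| := by
  rcases (le_sigma T t).eq_or_lt with hσ | hσ
  · exact (hφ.1 t (interval_subset_interval hcd ht) hσ.symm).abs.eventually_const_le
      (hr.trans_le (hφc t ht))
  · filter_upwards [self_mem_nhdsWithin, eventually_le_of_lt_sigma inter_subset_left hσ]
      with s hs hst
    exact hr.le.trans (hφc s ⟨hs.1, hs.2.1, hst.trans ht.2.2⟩)

/-- Near every point of `S`, delta derivatives on `[a, d]_T` are unique, the forward jump does not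
leave `[a, d]_T`, and `w = 1 / φ`: the local conditions under which a chain for `w` can be
identified with the functions `M_k y`. -/
def IsRegularNear (T : Set ℝ) (a d : ℝ) (φ w : ℝ → ℝ) (S : Set ℝ) : Prop :=
  ∀ t ∈ S, ∀ᶠ s in 𝓝[interval T a d] t,
    s ∈ kappa (interval T a d) ∧ sigma T s ≤ d ∧ φ s * w s = 1

theorem isRegularNear_cutoffInv (hd : d ∈ T) (hφ : RdContinuousOn T (interval T a d) φ)
    (hc : c ∈ kappa (interval T a d)) (hcd : sigma T c ≤ d) (hr : 0 < r) (hrA : r < A)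
    (hφc : ∀ s ∈ interval T a c, A ≤ |φ s|) :
    IsRegularNear T a d φ (fun t => cutoffInv r (φ t)) (interval T a c) := by
  intro t ht
  have hE : interval T a d ⊆ Iic d := fun s hs => hs.2.2
  filter_upwards [eventually_mem_kappa (mem_kappa_of_le hc ht),
    eventually_sigma_le hd hE ((sigma_le_sigma hc.1.1 ht.2.2).trans hcd),
    hφ.eventually_le_abs hc.1.2.2 hφc hrA ht] with s hsκ hsd hsφ
  exact ⟨hsκ, hsd, mul_cutoffInv_cancel hr hsφ⟩

theorem eventually_hasDeltaDeriv_congr {y z : ℝ → ℝ} (hE : E ⊆ T) (ht : t ∈ T)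
    (hσ : ∀ᶠ s in 𝓝[E] t, sigma T s ∈ E) (hyz : ∀ᶠ s in 𝓝[E] t, z s = y s)
    (hyzσ : z (sigma T t) = y (sigma T t)) :
    ∀ᶠ s in 𝓝[E] t, ∀ D, HasDeltaDeriv T E y D s → HasDeltaDeriv T E z D s := by
  filter_upwards [eventually_eventually_nhdsWithin.2 hyz, eventually_comp_sigma hE ht hσ hyz hyzσ]
    with s hs hsσ D hD using hD.congr hs hsσ

theorem sigma_mem_interval_iterate_succ (hT : IsClosed T) (hb : b ∈ T) {j : ℕ}
    (ht : t ∈ interval T a ((sigma T)^[j] b)) :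
    sigma T t ∈ interval T a ((sigma T)^[j + 1] b) := by
  rw [Function.iterate_succ_apply']
  exact ⟨sigma_mem hT ht.1, ht.2.1.trans (le_sigma T t),
    sigma_le_sigma (iterate_sigma_mem hT hb j) ht.2.2⟩

theorem interval_iterate_sigma_subset {i j : ℕ} (hij : i ≤ j) :
    interval T a ((sigma T)^[i] b) ⊆ interval T a ((sigma T)^[j] b) :=
  interval_subset_interval (monotone_iterate_sigma T b hij)

theorem IsDeltaChain.eventually_M_eq (hT : IsClosed T) (hb : b ∈ T) (hbd : (sigma T)^[n] b ≤ d)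
    (hm : IsDeltaChain T (interval T a d) w n m {t ∈ interval T a d | sigma T t ≤ d})
    (hreg : IsRegularNear T a d φ w (interval T a ((sigma T)^[n - 1] b)))
    {k j : ℕ} (hkj : k + j ≤ n) (ht : t ∈ interval T a ((sigma T)^[j] b)) :
    ∀ᶠ s in 𝓝[interval T a d] t, M T (interval T a d) φ k (m 0) s = m k s := by
  induction k generalizing j t with
  | zero => exact Eventually.of_forall fun s => rfl
  | succ k ih =>
    have hreg := hreg t (interval_iterate_sigma_subset (by omega) ht)
    have htσ := sigma_mem_interval_iterate_succ hT hb ht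
    have hσE : sigma T t ∈ interval T a d :=
      interval_subset_interval hbd (interval_iterate_sigma_subset (by omega) htσ)
    have hσ : ∀ᶠ s in 𝓝[interval T a d] t, sigma T s ∈ interval T a d := by
      filter_upwards [hreg, self_mem_nhdsWithin] with s hs hsE
      exact ⟨sigma_mem hT hsE.1, hsE.2.1.trans (le_sigma T s), hs.2.1⟩
    filter_upwards [hreg, self_mem_nhdsWithin, eventually_hasDeltaDeriv_congr inter_subset_left
      ht.1 hσ (ih (by omega) ht) ((ih (by omega) htσ).self_of_nhdsWithin hσE)]
      with s ⟨hsκ, hsd, hsw⟩ hsE hs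
    rw [M_succ, (hs _ (hm k (by omega) s ⟨hsE, hsd⟩)).deltaDeriv_eq hsκ, ← mul_assoc, hsw, one_mul]

theorem IsDeltaChain.cauchyEuler_eq (hT : IsClosed T) (hb : b ∈ T) (hbd : (sigma T)^[n] b ≤ d)
    (hm : IsDeltaChain T (interval T a d) w n m {t ∈ interval T a d | sigma T t ≤ d})
    (hreg : IsRegularNear T a d φ w (interval T a ((sigma T)^[n - 1] b)))
    (ht : t ∈ interval T a b) :
    cauchyEuler T (interval T a d) n α φ (m 0) t =
      ∑ k ∈ Finset.range (n + 1), α k * m k t := by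
  have htE := interval_subset_interval ((le_iterate_sigma T b n).trans hbd) ht
  refine Finset.sum_congr rfl fun k hk => congrArg (α k * ·) ?_
  exact (hm.eventually_M_eq hT hb hbd hreg (j := 0) (Nat.lt_succ_iff.1 (Finset.mem_range.1 hk))
    ht).self_of_nhdsWithin htE

theorem IsDeltaChain.hasDeltaDeriv_M (hT : IsClosed T) (hb : b ∈ T) (hbd : (sigma T)^[n] b ≤ d)
    (hm : IsDeltaChain T (interval T a d) w n m {t ∈ interval T a d | sigma T t ≤ d})
    (hreg : IsRegularNear T a d φ w (interval T a ((sigma T)^[n - 1] b)))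
    {k j : ℕ} (hkj : k + j < n) (ht : t ∈ interval T a ((sigma T)^[j] b)) :
    HasDeltaDeriv T (interval T a d) (M T (interval T a d) φ k (m 0)) (w t * m (k + 1) t) t := by
  have htσ := sigma_mem_interval_iterate_succ hT hb ht
  have hE {i : ℕ} (hi : i ≤ n) : interval T a ((sigma T)^[i] b) ⊆ interval T a d :=
    interval_subset_interval ((monotone_iterate_sigma T b hi).trans hbd)
  have hσE := hE (by omega) htσ
  exact (hm k (by omega) t ⟨hE (by omega) ht, hσE.2.2⟩).congr
    (hm.eventually_M_eq hT hb hbd hreg hkj.le ht)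
    ((hm.eventually_M_eq hT hb hbd hreg (by omega) htσ).self_of_nhdsWithin hσE)

theorem IsDeltaChain.crdOne_M (hT : IsClosed T) (hb : b ∈ T) (hbd : (sigma T)^[n] b ≤ d)
    (hm : IsDeltaChain T (interval T a d) w n m {t ∈ interval T a d | sigma T t ≤ d})
    (hreg : IsRegularNear T a d φ w (interval T a ((sigma T)^[n - 1] b)))
    {k : ℕ} (hk : k < n) (hw : RdContinuousOn T (interval T a d) w)
    (hmk : RdContinuousOn T (interval T a d) (m (k + 1))) :
    CrdOne T (interval T a d) (interval T a ((sigma T)^[n - 1 - k] b))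
      (M T (interval T a d) φ k (m 0)) := by
  have hE : interval T a ((sigma T)^[n - 1 - k] b) ⊆ interval T a d :=
    interval_subset_interval ((monotone_iterate_sigma T b (by omega)).trans hbd)
  have hderiv (t : ℝ) (ht : t ∈ interval T a ((sigma T)^[n - 1 - k] b)) :=
    hm.hasDeltaDeriv_M hT hb hbd hreg (k := k) (by omega) ht
  refine ⟨fun t ht => ⟨_, hderiv t ht⟩,
    ((hw.comp₂ continuous_mul hmk).mono hE).congr fun t ht => ?_⟩
  have hκ := (hreg t (interval_iterate_sigma_subset (by omega) ht)).self_of_nhdsWithin (hE ht)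
  exact (hderiv t ht).deltaDeriv_eq hκ.1

end Chain

section Stability

variable {T E : Set ℝ} {a b d t B ε : ℝ} {φ w x : ℝ → ℝ} {n : ℕ} {α : ℕ → ℝ}
  {m : ℕ → ℝ → ℝ}

/-- A chain with zero initial values whose combination `∑ α k * m k` is at most `ε` is itself at
most `chainBound n α B ℓ * ε` at distance `ℓ` from the initial point; `B` is a bound on `|w|`. -/
def chainBound (n : ℕ) (α : ℕ → ℝ) (B ℓ : ℝ) : ℝ :=
  1 + (1 + ∑ i : Fin n, |α i|) * gronwallBound 0 (B * (1 + ∑ i : Fin n, |α i|)) B ℓ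

theorem monotone_chainBound (n : ℕ) (α : ℕ → ℝ) (hB : 0 ≤ B) : Monotone (chainBound n α B) :=
  fun _ _ h => add_le_add_right (mul_le_mul_of_nonneg_left
    (gronwallBound_mono le_rfl hB (by positivity) h) (by positivity)) _

theorem chainBound_pos (n : ℕ) (α : ℕ → ℝ) {ℓ : ℝ} (hB : 0 ≤ B) (hℓ : 0 ≤ ℓ) :
    0 < chainBound n α B ℓ := by
  refine one_pos.trans_le ?_
  simpa [chainBound, gronwallBound_x0] using monotone_chainBound n α hB hℓ

theorem IsDeltaChain.abs_le_of_abs_sum_le (hT : IsClosed T) (ha : a ∈ T) (hE : interval T a b ⊆ E)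
    (hα : α n = 1) (hm : IsDeltaChain T E w n m (interval T a b))
    (hB : ∀ t ∈ interval T a b, |w t| ≤ B) (ha0 : ∀ k < n, m k a = 0)
    (hε : ∀ t ∈ interval T a b, |∑ k ∈ Finset.range (n + 1), α k * m k t| ≤ ε)
    {k : ℕ} (hk : k ≤ n) (ht : t ∈ interval T a b) :
    |m k t| ≤ chainBound n α B (t - a) * ε := by
  set L := 1 + ∑ i : Fin n, |α i|
  have : 0 ≤ L := by positivity
  have hB0 : 0 ≤ B := (abs_nonneg _).trans (hB t ht)
  have hε0 : 0 ≤ ε := (abs_nonneg _).trans (hε t ht)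
  have hjet (s : ℝ) (hs : s ∈ interval T a b) (j : ℕ) (hj : j ≤ n) :
      |m j s| ≤ ε + L * ‖fun i : Fin n => m i s‖ := by
    rw [← jet_sum_mul hα (fun i => m i s) hj]
    exact (abs_jet_le α _ _ j).trans (add_le_add_left (hε s hs) _)
  have hzero : (fun i : Fin n => m i a) = 0 := funext fun i => ha0 i i.2
  have hderiv (s : ℝ) (hs : s ∈ interval T a b) :
      ‖fun i : Fin n => w s * m (i + 1) s‖ ≤ B * L * ‖fun i : Fin n => m i s‖ + B * ε := by
    refine (pi_norm_le_iff_of_nonneg (by positivity)).2 fun i => ?_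
    calc ‖w s * m (i + 1) s‖ = |w s| * |m (i + 1) s| := abs_mul _ _
      _ ≤ B * (ε + L * ‖fun i : Fin n => m i s‖) := by
        gcongr
        exacts [hB s hs, hjet s hs _ i.2]
      _ = B * L * ‖fun i : Fin n => m i s‖ + B * ε := by ring
  have hgronwall : ‖fun i : Fin n => m i t‖ ≤ gronwallBound 0 (B * L) (B * ε) (t - a) :=
    norm_le_gronwallBound (W := fun s (i : Fin n) => m i s) hT ha hE (by positivity)
      (by positivity) (fun s hs i => hm i i.2 s hs) (by rw [hzero, norm_zero]) hderiv t ht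
  calc |m k t| ≤ ε + L * (gronwallBound 0 (B * L) (B * ε) (t - a)) :=
        (hjet t ht k hk).trans (by gcongr)
    _ = chainBound n α B (t - a) * ε := by rw [gronwallBound_zero_mul, chainBound]; ring

theorem abs_le_mul_one_add_pow {V : ℕ → ℕ → ℝ} {c : ℕ → ℝ} {C R : ℝ} (hC : ∀ j < n, |c j| ≤ C)
    (h0 : ∀ k ≤ n, |V k 0| ≤ R)
    (hstep : ∀ k j, k + j < n → V k (j + 1) = V k j + c j * V (k + 1) j) {k j : ℕ}
    (hkj : k + j ≤ n) : |V k j| ≤ R * (1 + C) ^ j := by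
  induction j generalizing k with
  | zero => simpa using h0 k hkj
  | succ j ih =>
    have hC := hC j (by omega)
    rw [hstep k j hkj]
    calc |V k j + c j * V (k + 1) j| ≤ |V k j| + |c j| * |V (k + 1) j| :=
          (abs_add_le _ _).trans_eq (by rw [abs_mul])
      _ ≤ R * (1 + C) ^ j + C * (R * (1 + C) ^ j) := by
          gcongr
          exacts [ih (by omega), (abs_nonneg _).trans hC, ih (by omega)]
      _ = R * (1 + C) ^ (j + 1) := by ring

theorem M_apply_sigma {k : ℕ} (ht : t ∈ E) (hw : φ t * w t = 1)
    (hx : t < sigma T t → ∃ D, HasDeltaDeriv T E (M T E φ k x) D t) :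
    M T E φ k x (sigma T t) = M T E φ k x t + w t * M T E φ (k + 1) x t * mu T t := by
  rcases (le_sigma T t).eq_or_lt with hσ | hσ
  · rw [mu, ← hσ, sub_self, mul_zero, add_zero]
  · rw [mul_M_succ hw]
    exact (deltaDeriv_spec (hx hσ)).apply_sigma ht

theorem exists_hasDeltaDeriv_iterate_sigma {y : ℝ → ℝ} (hE : E ⊆ T)
    (hb : ∃ D, HasDeltaDeriv T E y D b) {j : ℕ}
    (hj : (sigma T)^[j] b < sigma T ((sigma T)^[j] b)) :
    ∃ D, HasDeltaDeriv T E y D ((sigma T)^[j] b) := by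
  cases j with
  | zero => exact hb
  | succ j =>
    rw [Function.iterate_succ_apply'] at hj ⊢
    have hlt : (sigma T)^[j] b < sigma T ((sigma T)^[j] b) :=
      (le_sigma T _).lt_of_ne fun h => hj.ne (congrArg (sigma T) h)
    exact exists_hasDeltaDeriv_of_isolated hj (eventually_eq_sigma hE hlt hj) y

theorem IsDeltaChain.abs_M_sub_le_iterate_sigma (hT : IsClosed T) (hb : b ∈ T) (hab : a ≤ b)
    (hbd : (sigma T)^[n] b ≤ d)
    (hm : IsDeltaChain T (interval T a d) w n m {t ∈ interval T a d | sigma T t ≤ d})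
    (hw : ∀ t ∈ interval T a ((sigma T)^[n - 1] b), φ t * w t = 1)
    (hB : ∀ t ∈ interval T a d, |w t| ≤ B)
    (hx : ∀ k < n, ∃ D, HasDeltaDeriv T (interval T a d) (M T (interval T a d) φ k x) D b) {R : ℝ}
    (hR : ∀ k ≤ n, |M T (interval T a d) φ k x b - m k b| ≤ R) {k j : ℕ} (hkj : k + j ≤ n) :
    |M T (interval T a d) φ k x ((sigma T)^[j] b) - m k ((sigma T)^[j] b)|
      ≤ R * (1 + B * (d - a)) ^ j := by
  have hmem {i j : ℕ} (hij : i ≤ j) : (sigma T)^[i] b ∈ interval T a ((sigma T)^[j] b) :=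
    ⟨iterate_sigma_mem hT hb i, hab.trans (le_iterate_sigma T b i), monotone_iterate_sigma T b hij⟩
  have hE {i : ℕ} (hi : i ≤ n) : (sigma T)^[i] b ∈ interval T a d :=
    interval_subset_interval hbd (hmem hi)
  have hσ {i : ℕ} (hi : i < n) : sigma T ((sigma T)^[i] b) ∈ interval T a d := by
    rw [← Function.iterate_succ_apply' (sigma T)]
    exact hE hi
  refine abs_le_mul_one_add_pow
    (V := fun k j => M T (interval T a d) φ k x ((sigma T)^[j] b) - m k ((sigma T)^[j] b))
    (c := fun j => w ((sigma T)^[j] b) * mu T ((sigma T)^[j] b)) (fun i hi => ?_) hR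
    (fun k i hki => ?_) hkj
  · have hμ : 0 ≤ mu T ((sigma T)^[i] b) := sub_nonneg.2 (le_sigma T _)
    rw [abs_mul, abs_of_nonneg hμ]
    exact mul_le_mul (hB _ (hE hi.le)) (sub_le_sub (hσ hi).2.2 (hE hi.le).2.1) hμ
      ((abs_nonneg _).trans (hB _ (hE hi.le)))
  · simp only [Function.iterate_succ_apply']
    rw [M_apply_sigma (hE (by omega)) (hw _ (hmem (by omega)))
      (exists_hasDeltaDeriv_iterate_sigma inter_subset_left (hx k (by omega))),
      (hm k (by omega) _ ⟨hE (by omega), (hσ (by omega)).2.2⟩).apply_sigma (hE (by omega))]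
    ring

theorem IsDeltaChain.abs_M_sub_le (hT : IsClosed T) (ha : a ∈ T) (hE : interval T a b ⊆ E)
    (hα : α n = 1) (hm : IsDeltaChain T E w n m (interval T a b))
    (hw : ∀ t ∈ interval T a b, φ t * w t = 1) (hB : ∀ t ∈ interval T a b, |w t| ≤ B)
    (hx : ∀ k < n, ∀ t ∈ interval T a b, ∃ D, HasDeltaDeriv T E (M T E φ k x) D t)
    (hma : ∀ k < n, m k a = M T E φ k x a)
    (hε : ∀ t ∈ interval T a b,
      |cauchyEuler T E n α φ x t - ∑ k ∈ Finset.range (n + 1), α k * m k t| ≤ ε)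
    {k : ℕ} (hk : k ≤ n) (ht : t ∈ interval T a b) :
    |M T E φ k x t - m k t| ≤ chainBound n α B (t - a) * ε := by
  refine ((isDeltaChain_M hx hw).sub hm).abs_le_of_abs_sum_le hT ha hE hα hB
    (fun k hk => sub_eq_zero.2 (hma k hk).symm) (fun s hs => ?_) hk ht
  simpa only [cauchyEuler, mul_sub, Finset.sum_sub_distrib] using hε s hs

theorem IsDeltaChain.abs_sub_le (hT : IsClosed T) (ha : a ∈ T) (hb : b ∈ T) (hab : a ≤ b)
    (hbd : (sigma T)^[n] b ≤ d) (hα : α n = 1)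
    (hm : IsDeltaChain T (interval T a d) w n m {t ∈ interval T a d | sigma T t ≤ d})
    (hw : ∀ t ∈ interval T a ((sigma T)^[n - 1] b), φ t * w t = 1)
    (hB : ∀ t ∈ interval T a d, |w t| ≤ B)
    (hx : ∀ k < n, ∀ t ∈ interval T a b,
      ∃ D, HasDeltaDeriv T (interval T a d) (M T (interval T a d) φ k x) D t)
    (hma : ∀ k < n, m k a = M T (interval T a d) φ k x a)
    (hε : ∀ t ∈ interval T a b, |cauchyEuler T (interval T a d) n α φ x t
      - ∑ k ∈ Finset.range (n + 1), α k * m k t| ≤ ε)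
    (ht : t ∈ interval T a ((sigma T)^[n] b)) :
    |x t - m 0 t| ≤ chainBound n α B (b - a) * (1 + B * (d - a)) ^ n * ε := by
  have hE : interval T a b ⊆ interval T a d :=
    interval_subset_interval ((le_iterate_sigma T b n).trans hbd)
  have hbE : b ∈ interval T a b := ⟨hb, hab, le_rfl⟩
  have hB0 : 0 ≤ B := (abs_nonneg _).trans (hB b (hE hbE))
  have hε0 : 0 ≤ ε := (abs_nonneg _).trans (hε b hbE)
  have hda : 0 ≤ d - a := sub_nonneg.2 (hab.trans (hE hbE).2.2)
  set R := chainBound n α B (b - a) * ε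
  have hR0 : 0 ≤ R :=
    mul_nonneg (chainBound_pos n α hB0 (sub_nonneg.2 hab)).le hε0
  have hR {s : ℝ} (hs : s ∈ interval T a b) {k : ℕ} (hk : k ≤ n) :
      |M T (interval T a d) φ k x s - m k s| ≤ R := by
    have hmb : IsDeltaChain T (interval T a d) w n m (interval T a b) := fun i hi r hr =>
      hm i hi r ⟨hE hr, (interval_subset_interval hbd (interval_iterate_sigma_subset (by omega)
        (sigma_mem_interval_iterate_succ hT hb (j := 0) hr))).2.2⟩
    refine (hmb.abs_M_sub_le hT ha hE hα
      (fun s hs => hw s (interval_subset_interval (le_iterate_sigma T b _) hs))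
      (fun s hs => hB s (hE hs)) hx hma hε hk hs).trans ?_
    exact mul_le_mul_of_nonneg_right (monotone_chainBound n α hB0 (sub_le_sub_right hs.2.2 a)) hε0
  suffices h : ∃ j ≤ n, |x t - m 0 t| ≤ R * (1 + B * (d - a)) ^ j by
    obtain ⟨j, hj, hjt⟩ := h
    refine hjt.trans ((mul_le_mul_of_nonneg_left (pow_le_pow_right₀ ?_ hj) hR0).trans_eq ?_)
    · exact le_add_of_nonneg_right (mul_nonneg hB0 hda)
    · exact mul_right_comm _ _ _
  rcases le_or_gt t b with htb | htb
  · exact ⟨0, n.zero_le, by simpa [M] using hR ⟨ht.1, ht.2.1, htb⟩ n.zero_le⟩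
  · obtain ⟨j, hj, rfl⟩ := exists_iterate_sigma_eq ht.1 htb ht.2.2
    exact ⟨j, hj, hm.abs_M_sub_le_iterate_sigma (k := 0) hT hb hab hbd hw hB
      (fun k hk => hx k hk b hbE) (fun k hk => hR hbE hk) ((zero_add j).trans_le hj)⟩

end Stability

end TimeScale

end

open TimeScale in
theorem theorem2p4_general
    (T : Set ℝ) (hT : IsClosed T)
    (n : ℕ) (hn : 1 ≤ n)
    (a b d : ℝ) (ha : a ∈ T) (hb : b ∈ T) (hd : d ∈ T) (hab : a ≤ b)
    (hbd : (sigma T)^[n] b ≤ d)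
    (hκ : (sigma T)^[n - 1] b ∈ kappa (interval T a d))
    (φ f : ℝ → ℝ)
    (hφ : RdContinuousOn T (interval T a d) φ)
    (hf : RdContinuousOn T (interval T a d) f)
    (A : ℝ) (hA : 0 < A)
    (hφA : ∀ t ∈ interval T a ((sigma T)^[n - 1] b), A ≤ |φ t|)
    (α : ℕ → ℝ) (hαn : α n = 1) :
    HyersUlamStable T (interval T a d) a b n α φ f := by
  have hcd : sigma T ((sigma T)^[n - 1] b) ≤ d := by
    rwa [← Function.iterate_succ_apply' (sigma T), Nat.succ_eq_add_one, Nat.sub_add_cancel hn]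
  have hda : 0 ≤ d - a := sub_nonneg.2 (hκ.1.2.1.trans hκ.1.2.2)
  have hr : 0 < A / 2 := half_pos hA
  have hreg := isRegularNear_cutoffInv hd hφ hκ hcd hr (half_lt_self hA) hφA
  have hw : RdContinuousOn T (interval T a d) fun t => cutoffInv (A / 2) (φ t) :=
    hφ.comp₂ ((continuous_cutoffInv hr.ne').comp continuous_fst) hφ
  have hbound : 0 < chainBound n α (A / 2)⁻¹ (b - a) :=
    chainBound_pos n α (by positivity) (sub_nonneg.2 hab)
  refine ⟨chainBound n α (A / 2)⁻¹ (b - a) * (1 + (A / 2)⁻¹ * (d - a)) ^ n, by positivity,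
    fun ε _ x hx hxε => ?_⟩
  obtain ⟨Z, hZ, hZrd, hZf, hZa⟩ := exists_isDeltaChain hT ha (sub_nonneg.1 hda) hf hw hαn
    fun k => M T (interval T a d) φ k x a
  have heq (t : ℝ) (ht : t ∈ interval T a b) :
      cauchyEuler T (interval T a d) n α φ (Z 0) t = f t :=
    (hZ.cauchyEuler_eq hT hb hbd hreg ht).trans (hZf t)
  have herr (t : ℝ) := hZ.abs_sub_le (t := t) hT ha hb hab hbd hαn
    (fun s hs => mul_cutoffInv_cancel hr ((half_le_self hA.le).trans (hφA s hs)))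
    (fun s _ => abs_cutoffInv_le hr (φ s)) (fun k hk => (hx k hk).1) hZa
    (by simpa only [hZf] using hxε)
  exact ⟨Z 0, fun k hk => hZ.crdOne_M hT hb hbd hreg hk hw (hZrd (k + 1)), heq, herr⟩

theorem theorem2p4
    -- a time scale, and the interval `[a, d]_T ⊇ [a, σⁿ(b)]_T` on which the functions are given
    (T : Set ℝ) (hT : IsClosed T)
    (n : ℕ) (hn : 1 ≤ n)
    (a b d : ℝ) (ha : a ∈ T) (hb : b ∈ T) (hd : d ∈ T) (hab : a ≤ b)
    (hbd : (TimeScale.sigma T)^[n] b ≤ d)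
    -- the derivatives that the equation on `[a, b]_T` involves make sense
    (hκ : (TimeScale.sigma T)^[n - 1] b ∈ TimeScale.kappa (TimeScale.interval T a d))
    (φ f : ℝ → ℝ)
    (hφ : TimeScale.RdContinuousOn T (TimeScale.interval T a d) φ)
    (hf : TimeScale.RdContinuousOn T (TimeScale.interval T a d) f)
    (A : ℝ) (hA : 0 < A)
    (hφA : ∀ t ∈ TimeScale.interval T a ((TimeScale.sigma T)^[n - 1] b), A ≤ |φ t|)
    (α : ℕ → ℝ) (hαn : α n = 1)
    -- the characteristic values
    (lam : Fin n → ℂ)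
    (hlam : ∀ k ≤ n, (α k : ℂ) = TimeScale.elemSymm (n - k) (fun i => -lam i))
    (hreg : ∀ i : Fin n, ∀ t ∈ TimeScale.interval T a ((TimeScale.sigma T)^[n - 1] b),
      (φ t : ℂ) + lam i * (TimeScale.mu T t : ℂ) ≠ 0) :
    TimeScale.HyersUlamStable T (TimeScale.interval T a d) a b n α φ f :=
  theorem2p4_general T hT n hn a b d ha hb hd hab hbd hκ φ f hφ hf A hA hφA α hαn
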